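/- Let $V$ be a finite set and let $L$ be an abstract simplicial complex with vertex set $V$ (so every $v\in V$ is a vertex of $L$; the empty simplex is counted among the simplices of $L$). Let $T_L\subseteq (S^1)^V$ be the toric complex of $L$, $$T_L=\bigcup_{\tau\in L}\{x\in (S^1)^V : x_v=1 \text{ for all } v\notin\tau\},$$ with its standard cell structure, which has one cell of dimension $|\sigma|$ for each simplex $\sigma\in L$. Let $G_L=\pi_1(T_L)$. For a commutative ring $\Bbbk$ and a $\Bbbk[G_L]$-module $A$, let $H^p(T_L,A)$ denote the (cellular) cohomology of $T_L$ with coefficients in the local system defined by $A$. For an integer $d$, call $L$ a $d$-dimensional Cohen–Macaulay complex over $\Bbbk$ if $\dim L=d$ and, for every simplex $\sigma\in L$ (including $\sigma=\emptyset$), the reduced cohomology $\widetilde H^j(\mathrm{lk}(\sigma),\Bbbk)$ vanishes for $j\ne d-|\sigma|$ and is a torsion-free $\Bbbk$-module for $j=d-|\sigma|$. **Theorem.** Let $\Bbbk$ be $\mathbb Z$ or a field, let $A=\Bbbk[G_L^{\mathrm{ab}}]$, and let $d$ be an integer. Then $L$ is a $d$-dimensional Cohen–Macaulay complex over $\Bbbk$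 if and only if $H^p(T_L,A)=0$ for all $p\neq d+1$ and $H^{d+1}(T_L,A)$ is a free $\Bbbk$-module. In particular, say that a connected CW complex $X$ with finitely many cells in each dimension is an abelian duality space of dimension $n$ if $H^p(X,\mathbb Z[\pi_1(X)^{\mathrm{ab}}])=0$ for all $p\ne n$ and $H^n(X,\mathbb Z[\pi_1(X)^{\mathrm{ab}}])$ is nonzero and torsion-free. Then $T_L$ is an abelian duality space of dimension $n$ if and only if $L$ is an $(n-1)$-dimensional Cohen–Macaulay complex over $\mathbb Z$; hence $T_L$ is an abelian duality space (of some dimension) if and only if $L$ is Cohen–Macaulay over $\mathbb Z$ (of some dimension). -/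

import Mathlib

universe u v w

noncomputable section

/-! ### Simplicial complexes: simplices, links, reduced cohomology, Cohen-Macaulayness -/

namespace PreAbstractSimplicialComplex

variable {V : Type u}

/-- The simplices of `K` in the sense of the reduced theory: the empty simplex, and the faces. -/
def simplices (K : PreAbstractSimplicialComplex V) : Set (Finset V) :=
  {σ | σ = ∅ ∨ σ ∈ K.faces}

theorem simplices_of_subset (K : PreAbstractSimplicialComplex V) {σ τ : Finset V}
    (hσ : σ ∈ K.simplices) (h : τ ⊆ σ) : τ ∈ K.simplices := by
  rcases τ.eq_empty_or_nonempty with h0 | h0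
  · exact Or.inl h0
  · rcases hσ with rfl | hσ
    · exact Or.inl (Finset.subset_empty.mp h)
    · exact Or.inr ((K.isRelLowerSet_faces hσ).2 h h0)

/-- `K` has dimension `d`: the largest simplices of `K` have exactly `d + 1` elements
(so the complex whose only simplex is `∅` has dimension `-1`). -/
def HasDim (K : PreAbstractSimplicialComplex V) (d : ℤ) : Prop :=
  (∀ σ ∈ K.simplices, (σ.card : ℤ) ≤ d + 1) ∧ ∃ σ ∈ K.simplices, (σ.card : ℤ) = d + 1

/-- The simplices of `K` with exactly `n` vertices, i.e. of dimension `n - 1`. -/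
@[ext]
structure Simplex (K : PreAbstractSimplicialComplex V) (n : ℕ) : Type u where
  /-- the set of vertices of the simplex -/
  verts : Finset V
  mem_simplices : verts ∈ K.simplices
  card_eq : verts.card = n

variable [LinearOrder V]

/-- The link of `σ`: the sets `τ` disjoint from `σ` such that `σ ∪ τ` is a simplex. -/
def link (K : PreAbstractSimplicialComplex V) (σ : Finset V) :
    PreAbstractSimplicialComplex V where
  faces := {τ | τ.Nonempty ∧ Disjoint σ τ ∧ σ ∪ τ ∈ K.simplices}
  isRelLowerSet_faces := by
    rintro τ ⟨h0, h1, h2⟩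
    refine ⟨h0, fun τ' h h' => ⟨h', h1.mono_right h, K.simplices_of_subset h2 ?_⟩⟩
    exact Finset.union_subset_union_right h

/-- The vertices of a simplex, listed in increasing order. -/
def Simplex.vertex {K : PreAbstractSimplicialComplex V} {n : ℕ} (σ : K.Simplex n) : Fin n ↪o V :=
  σ.verts.orderEmbOfFin σ.card_eq

theorem Simplex.vertex_mem {K : PreAbstractSimplicialComplex V} {n : ℕ} (σ : K.Simplex n)
    (i : Fin n) : σ.vertex i ∈ σ.verts :=
  Finset.orderEmbOfFin_mem _ _ _

theorem Simplex.exists_vertex {K : PreAbstractSimplicialComplex V} {n : ℕ} (σ : K.Simplex n)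
    {v : V} (hv : v ∈ σ.verts) : ∃ i, σ.vertex i = v := by
  have : v ∈ Set.range (σ.verts.orderEmbOfFin σ.card_eq) := by
    rwa [Finset.range_orderEmbOfFin]
  exact this

/-- The `i`-th facet of a simplex: delete its `i`-th vertex. -/
def Simplex.facet {K : PreAbstractSimplicialComplex V} {n : ℕ} (i : Fin (n + 1))
    (σ : K.Simplex (n + 1)) : K.Simplex n :=
  ⟨σ.verts.erase (σ.vertex i), K.simplices_of_subset σ.mem_simplices (Finset.erase_subset _ _), by
    rw [Finset.card_erase_of_mem (σ.vertex_mem i), σ.card_eq, Nat.add_sub_cancel]⟩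

variable (K : PreAbstractSimplicialComplex V) (k : Type w) [CommRing k]

/-- The coboundary of the augmented oriented simplicial cochain complex of `K`. A cochain on
simplices with `n` vertices has degree `n - 1`. -/
def coboundary (n : ℕ) : (K.Simplex n → k) →ₗ[k] (K.Simplex (n + 1) → k) where
  toFun f σ := ∑ i : Fin (n + 1), (-1 : k) ^ (i : ℕ) * f (σ.facet i)
  map_add' f g := by
    funext σ
    simp [mul_add, Finset.sum_add_distrib]
  map_smul' a f := by
    funext σ
    simp [Finset.mul_sum, mul_left_comm]

/-- The coboundaries among the cochains on simplices with `n` vertices. -/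
def coboundaries : (n : ℕ) → Submodule k (K.Simplex n → k)
  | 0 => ⊥
  | n + 1 => LinearMap.range (K.coboundary k n)

/-- `K.shiftedReducedCohomology k n` is the reduced simplicial cohomology of `K` over `k` in
degree `n - 1`. (There is no reduced cohomology in degrees below `-1`.) -/
abbrev shiftedReducedCohomology (n : ℕ) : Type (max u w) :=
  ↥(LinearMap.ker (K.coboundary k n)) ⧸
    (K.coboundaries k n).submoduleOf (LinearMap.ker (K.coboundary k n))

/-- `K` is a `d`-dimensional Cohen-Macaulay complex over `k`: it has dimension `d` and, for each
simplex `σ` (the empty one included), the reduced cohomology of the link of `σ` with coefficients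
in `k` vanishes in all degrees `j ≠ d - |σ|` and is torsion-free over `k` in degree
`j = d - |σ|`. Here `j = n - 1`. -/
def IsCohenMacaulay (d : ℤ) : Prop :=
  K.HasDim d ∧ ∀ σ ∈ K.simplices, ∀ n : ℕ,
    ((n : ℤ) - 1 ≠ d - σ.card → Subsingleton ((K.link σ).shiftedReducedCohomology k n)) ∧
    ((n : ℤ) - 1 = d - σ.card → Module.IsTorsionFree k ((K.link σ).shiftedReducedCohomology k n))

end PreAbstractSimplicialComplex

/-! ### Cubical cell complexes with one vertex, and their cohomology with local coefficients -/

/-- A CW structure on `X` whose only vertex is `x₀`, whose closed cells are given by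
characteristic maps on the cubes `[0,1]ⁿ`, and such that the restriction of a characteristic map
to each facet of the cube is again a characteristic map. As a set, `X` is the disjoint union of
the open cells, each in bijection with `(0,1)ⁿ`, and `X` has the weak topology. -/
structure CubicalStructure (X : Type u) [TopologicalSpace X] (x₀ : X) where
  /-- the `n`-cells -/
  Cell : ℕ → Type v
  /-- the characteristic maps -/
  char : ∀ {n : ℕ}, Cell n → C(Fin n → unitInterval, X)
  /-- the facet `xᵢ = 0` -/
  face₀ : ∀ {n : ℕ}, Fin (n + 1) → Cell (n + 1) → Cell n
  /-- the facet `xᵢ = 1` -/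
  face₁ : ∀ {n : ℕ}, Fin (n + 1) → Cell (n + 1) → Cell n
  char_face₀ : ∀ {n : ℕ} (i : Fin (n + 1)) (c : Cell (n + 1)) (x : Fin n → unitInterval),
    char (face₀ i c) x = char c (i.insertNth (α := fun _ => unitInterval) 0 x)
  char_face₁ : ∀ {n : ℕ} (i : Fin (n + 1)) (c : Cell (n + 1)) (x : Fin n → unitInterval),
    char (face₁ i c) x = char c (i.insertNth (α := fun _ => unitInterval) 1 x)
  char_corner : ∀ {n : ℕ} (c : Cell n) (x : Fin n → unitInterval), (∀ i, x i = 0 ∨ x i = 1) →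
    char c x = x₀
  existsUnique_cell : ∀ y : X, ∃! p : (Σ n : ℕ, Cell n × (Fin n → unitInterval)),
    (∀ i, 0 < p.2.2 i ∧ p.2.2 i < 1) ∧ char p.2.1 p.2.2 = y
  isClosed_of_cells : ∀ S : Set X, (∀ (n : ℕ) (c : Cell n), IsClosed (char c ⁻¹' S)) → IsClosed S

namespace CubicalStructure

variable {X : Type u} [TopologicalSpace X] {x₀ : X} (S : CubicalStructure.{u, v} X x₀)

/-- The loop at `x₀` traced by the edge of the cube from the corner `0` in direction `i`. -/
def edgePath {n : ℕ} (c : S.Cell n) (i : Fin n) : Path x₀ x₀ where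
  toFun t := S.char c (Function.update (fun _ => 0) i t)
  continuous_toFun :=
    (S.char c).continuous.comp (continuous_const.update i continuous_id)
  source' := S.char_corner c _ fun j => Or.inl (by simp [Function.update_apply])
  target' := S.char_corner c _ fun j => by
    rcases eq_or_ne j i with rfl | h
    · simp
    · simp [h]

/-- The class of `edgePath` in the fundamental group. -/
def edge {n : ℕ} (c : S.Cell n) (i : Fin n) : FundamentalGroup X x₀ :=
  FundamentalGroup.fromPath (Path.Homotopic.Quotient.mk (S.edgePath c i))

variable {k : Type w} [CommRing k] {M : Type*} [AddCommGroup M] [Module k M]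
  (ρ : Representation k (FundamentalGroup X x₀) M)

/-- The cellular (cubical) coboundary with coefficients in the local system on `X` with fibre `M`
at `x₀` and monodromy `ρ`. The value of a cochain on a cell is a vector in the fibre over the image
of the corner `0`. The `0`-corner of the facet `xᵢ = 1` is the far end of the `i`-th edge, so the
value on that facet is transported back along this edge; the facet `xᵢ = 0` has the same
`0`-corner as the cell. Equivalently, this is the complex of equivariant cochains on the cells of
the universal cover of `X`. -/
def coboundary (n : ℕ) : (S.Cell n → M) →ₗ[k] (S.Cell (n + 1) → M) where
  toFun f c := ∑ i : Fin (n + 1),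
    (-1 : k) ^ (i : ℕ) • (ρ (S.edge c i)⁻¹ (f (S.face₁ i c)) - f (S.face₀ i c))
  map_add' f g := by
    funext c
    simp only [Pi.add_apply, map_add, ← Finset.sum_add_distrib, ← smul_add]
    exact Finset.sum_congr rfl fun i _ => by rw [add_sub_add_comm]
  map_smul' a f := by
    funext c
    simp only [Pi.smul_apply, map_smul, ← smul_sub, Finset.smul_sum, RingHom.id_apply]
    exact Finset.sum_congr rfl fun i _ => smul_comm _ _ _

/-- The cellular coboundaries in degree `n`. -/
def coboundaries : (n : ℕ) → Submodule k (S.Cell n → M)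
  | 0 => ⊥
  | n + 1 => LinearMap.range (S.coboundary ρ n)

/-- The cohomology `Hⁿ(X, M)` with coefficients in the local system given by `ρ`. -/
abbrev Cohomology (n : ℕ) :=
  ↥(LinearMap.ker (S.coboundary ρ n)) ⧸
    (S.coboundaries ρ n).submoduleOf (LinearMap.ker (S.coboundary ρ n))

end CubicalStructure

/-- The group algebra `k[Gᵃᵇ]` as a representation of `G`, acting by left multiplication through
the projection `G → Gᵃᵇ`. -/
def abelianRep (k : Type w) [CommRing k] (G : Type u) [Group G] :
    Representation k G (MonoidAlgebra k (Abelianization G)) :=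
  ((Algebra.lmul k (MonoidAlgebra k (Abelianization G))).toRingHom.toMonoidHom.comp
    (MonoidAlgebra.of k (Abelianization G))).comp Abelianization.of

/-- `X`, with the given (connected) cell structure, is an abelian duality space of dimension `n`:
it has finitely many cells in each dimension, `H^p(X, ℤ[π₁(X)ᵃᵇ]) = 0` for `p ≠ n`, and
`H^n(X, ℤ[π₁(X)ᵃᵇ])` is nonzero and torsion-free. -/
def CubicalStructure.IsAbelianDualitySpace {X : Type u} [TopologicalSpace X] {x₀ : X}
    (S : CubicalStructure.{u, v} X x₀) (n : ℕ) : Prop :=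
  (∀ q, Finite (S.Cell q)) ∧
  (∀ p, p ≠ n → Subsingleton (S.Cohomology (abelianRep ℤ (FundamentalGroup X x₀)) p)) ∧
  Nontrivial (S.Cohomology (abelianRep ℤ (FundamentalGroup X x₀)) n) ∧
  Module.IsTorsionFree ℤ (S.Cohomology (abelianRep ℤ (FundamentalGroup X x₀)) n)

/-! ### Toric complexes -/

namespace AbstractSimplicialComplex

variable {V : Type u}

/-- The generalized moment-angle complex (polyhedral product) `Z_L(X, Y)`, the union over the
simplices `τ` of `L` of the sets of points `x` with `x v ∈ X` for `v ∈ τ` and `x v ∈ Y` for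
`v ∉ τ`. -/
def momentAngle (L : AbstractSimplicialComplex V) (X : Type v) (Y : Set X) : Set (V → X) :=
  ⋃ τ ∈ L.simplices, {x | ∀ v, v ∉ τ → x v ∈ Y}

/-- The toric complex `T_L = Z_L(S¹, e⁰)`, a subspace of the torus `V → S¹`. -/
abbrev Toric (L : AbstractSimplicialComplex V) : Type u :=
  ↥(L.momentAngle Circle {1})

/-- The base point of the toric complex. -/
def toricBase (L : AbstractSimplicialComplex V) : L.Toric :=
  ⟨1, Set.mem_biUnion (x := ∅) (show ∅ ∈ L.simplices from Or.inl rfl) fun _ _ => rfl⟩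

/-- The fundamental group `G_L` of the toric complex. -/
abbrev ToricGroup (L : AbstractSimplicialComplex V) : Type u :=
  FundamentalGroup L.Toric L.toricBase

variable [LinearOrder V] (L : AbstractSimplicialComplex V)

/-- The characteristic map of the cell of the toric complex given by the simplex `σ`: it sends
`x ∈ [0,1]ⁿ` to the point of the torus with coordinate `exp(2πi x_j)` at the `j`-th vertex of `σ`
and coordinate `1` at the vertices outside of `σ`. -/
def toricChar {n : ℕ} (σ : L.Simplex n) : C(Fin n → unitInterval, L.Toric) where
  toFun x := ⟨Function.extend σ.vertex
      (fun j => Circle.exp (2 * Real.pi * (x j : ℝ))) 1, by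
    refine Set.mem_biUnion (x := σ.verts) σ.mem_simplices fun v hv => ?_
    rw [Function.extend_apply']
    · rfl
    · rintro ⟨j, rfl⟩
      exact hv (σ.vertex_mem j)⟩
  continuous_toFun := by
    refine Continuous.subtype_mk (continuous_pi fun v => ?_) _
    by_cases h : ∃ j, σ.vertex j = v
    · obtain ⟨j, rfl⟩ := h
      simp only [σ.vertex.injective.extend_apply]
      fun_prop
    · simp only [Function.extend_apply' _ _ _ h]
      exact continuous_const

theorem toricChar_vertex {n : ℕ} (σ : L.Simplex n) (x : Fin n → unitInterval) (j : Fin n) :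
    (L.toricChar σ x).1 (σ.vertex j) = Circle.exp (2 * Real.pi * (x j : ℝ)) := by
  exact σ.vertex.injective.extend_apply (fun j => Circle.exp (2 * Real.pi * (x j : ℝ))) 1 j

theorem toricChar_of_notMem {n : ℕ} (σ : L.Simplex n) (x : Fin n → unitInterval) {v : V}
    (hv : v ∉ σ.verts) : (L.toricChar σ x).1 v = 1 := by
  refine Function.extend_apply' (fun j => Circle.exp (2 * Real.pi * (x j : ℝ))) (1 : V → Circle) v ?_
  rintro ⟨j, rfl⟩
  exact hv (σ.vertex_mem j)

theorem toricChar_facet {n : ℕ} (i : Fin (n + 1)) (σ : L.Simplex (n + 1)) (x : Fin n → unitInterval)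
    (ε : unitInterval) (hε : Circle.exp (2 * Real.pi * (ε : ℝ)) = 1) :
    L.toricChar (σ.facet i) x =
      L.toricChar σ (i.insertNth (α := fun _ => unitInterval) ε x) := by
  have key : ∀ j, (σ.facet i).vertex j = σ.vertex (i.succAbove j) := by
    have := Finset.orderEmbOfFin_unique (s := (σ.facet i).verts) (σ.facet i).card_eq
      (f := fun j => σ.vertex (i.succAbove j)) (fun j => by
        refine Finset.mem_erase.mpr ⟨?_, σ.vertex_mem _⟩
        exact fun h => Fin.succAbove_ne i j (σ.vertex.injective h))
      (σ.vertex.strictMono.comp (Fin.strictMono_succAbove i))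
    exact fun j => (congrFun this j).symm
  refine Subtype.ext (funext fun v => ?_)
  by_cases hv : v ∈ σ.verts
  · obtain ⟨j, rfl⟩ := σ.exists_vertex hv
    rw [toricChar_vertex]
    rcases Fin.eq_self_or_eq_succAbove i j with rfl | ⟨j, rfl⟩
    · rw [toricChar_of_notMem _ _ _ (Finset.notMem_erase _ _), Fin.insertNth_apply_same, hε]
    · rw [← key, toricChar_vertex, Fin.insertNth_apply_succAbove]
  · rw [toricChar_of_notMem _ _ _ hv, toricChar_of_notMem]
    exact fun h => hv (Finset.mem_of_mem_erase h)

theorem exp_injOn_Ico {s t : ℝ} (hs : s ∈ Set.Ico 0 1) (ht : t ∈ Set.Ico 0 1)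
    (h : Circle.exp (2 * Real.pi * s) = Circle.exp (2 * Real.pi * t)) : s = t := by
  obtain ⟨m, hm⟩ := Circle.exp_eq_exp.mp h
  have h1 : s = t + m := by
    have : (2 * Real.pi) * s = (2 * Real.pi) * (t + m) := by rw [hm]; ring
    exact mul_left_cancel₀ (by positivity) this
  have h2 : (m : ℝ) < 1 := by linarith [hs.2, ht.1]
  have h3 : (-1 : ℝ) < m := by linarith [hs.1, ht.2]
  have h4 : m < 1 := by exact_mod_cast h2
  have h5 : -1 < m := by exact_mod_cast h3
  have h6 : m = 0 := by omega
  simpa [h6] using h1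

theorem exp_ne_one {t : unitInterval} (ht : 0 < t ∧ t < 1) :
    Circle.exp (2 * Real.pi * (t : ℝ)) ≠ 1 := by
  intro h
  have h0 : (t : ℝ) = 0 := exp_injOn_Ico ⟨ht.1.le, ht.2⟩ ⟨le_rfl, one_pos⟩ (by simpa using h)
  exact ht.1.ne' (Subtype.ext h0)

theorem exists_exp_eq {z : Circle} (hz : z ≠ 1) :
    ∃ t : unitInterval, (0 < t ∧ t < 1) ∧ Circle.exp (2 * Real.pi * (t : ℝ)) = z := by
  obtain ⟨r, rfl⟩ := Circle.exp_surjective z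
  have hpi : (2 * Real.pi) ≠ 0 := by positivity
  have he : Circle.exp (2 * Real.pi * Int.fract (r / (2 * Real.pi))) = Circle.exp r := by
    refine Circle.exp_eq_exp.mpr ⟨-⌊r / (2 * Real.pi)⌋, ?_⟩
    rw [Int.fract]
    push_cast
    field_simp
    ring
  have h0 : Int.fract (r / (2 * Real.pi)) ≠ 0 := by
    intro h
    rw [h, mul_zero, Circle.exp_zero] at he
    exact hz he.symm
  have h1 := Int.fract_nonneg (r / (2 * Real.pi))
  have h2 := Int.fract_lt_one (r / (2 * Real.pi))
  refine ⟨⟨Int.fract (r / (2 * Real.pi)), h1, h2.le⟩, ⟨?_, ?_⟩, he⟩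
  · exact lt_of_le_of_ne (α := ℝ) h1 h0.symm
  · exact h2

theorem mem_verts_iff_of_interior {n : ℕ} (σ : L.Simplex n) (x : Fin n → unitInterval)
    (hx : ∀ i, 0 < x i ∧ x i < 1) (v : V) : v ∈ σ.verts ↔ (L.toricChar σ x).1 v ≠ 1 := by
  constructor
  · intro hv
    obtain ⟨j, rfl⟩ := σ.exists_vertex hv
    rw [toricChar_vertex]
    exact exp_ne_one (hx j)
  · intro h
    by_contra hv
    exact h (L.toricChar_of_notMem σ x hv)

theorem exists_cell (y : L.Toric) : ∃ (n : ℕ) (σ : L.Simplex n) (x : Fin n → unitInterval),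
    (∀ i, 0 < x i ∧ x i < 1) ∧ L.toricChar σ x = y := by
  classical
  obtain ⟨τ, hτ, hy⟩ := Set.mem_iUnion₂.mp y.2
  have hy' : ∀ v, v ∉ τ → y.1 v = 1 := hy
  let σ : L.Simplex _ :=
    ⟨τ.filter (fun v => y.1 v ≠ 1), L.simplices_of_subset hτ (Finset.filter_subset _ _), rfl⟩
  have h1 : ∀ v, v ∈ σ.verts ↔ y.1 v ≠ 1 := fun v => by
    refine (Finset.mem_filter).trans ⟨fun h => h.2, fun h => ⟨?_, h⟩⟩
    by_contra hv
    exact h (hy' v hv)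
  choose x hx hx' using fun i => exists_exp_eq ((h1 _).mp (σ.vertex_mem i))
  refine ⟨_, σ, x, hx, Subtype.ext (funext fun v => ?_)⟩
  by_cases hv : v ∈ σ.verts
  · obtain ⟨j, rfl⟩ := σ.exists_vertex hv
    rw [toricChar_vertex, hx']
  · rw [toricChar_of_notMem _ _ _ hv]
    by_contra h
    exact hv ((h1 v).mpr (Ne.symm h))

theorem cell_unique {n m : ℕ} (σ : L.Simplex n) (τ : L.Simplex m) (x : Fin n → unitInterval)
    (y : Fin m → unitInterval) (hx : ∀ i, 0 < x i ∧ x i < 1) (hy : ∀ i, 0 < y i ∧ y i < 1)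
    (h : L.toricChar σ x = L.toricChar τ y) :
    (⟨n, σ, x⟩ : Σ n : ℕ, L.Simplex n × (Fin n → unitInterval)) = ⟨m, τ, y⟩ := by
  have h1 : σ.verts = τ.verts := Finset.ext fun v => by
    rw [mem_verts_iff_of_interior L σ x hx, mem_verts_iff_of_interior L τ y hy, h]
  obtain rfl : n = m := by rw [← σ.card_eq, ← τ.card_eq, h1]
  obtain rfl : σ = τ := PreAbstractSimplicialComplex.Simplex.ext h1
  obtain rfl : x = y := funext fun j => by
    have := congrArg (fun z => z.1 (σ.vertex j)) h
    simp only [toricChar_vertex] at this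
    exact Subtype.ext
      (exp_injOn_Ico ⟨(hx j).1.le, (hx j).2⟩ ⟨(hy j).1.le, (hy j).2⟩ this)
  rfl

/-- The standard cell structure of the toric complex: the cells of dimension `n` correspond to the
simplices of `L` with `n` vertices. -/
def toricCells [Finite V] : CubicalStructure.{u, u} L.Toric L.toricBase where
  Cell n := L.Simplex n
  char σ := L.toricChar σ
  face₀ i σ := σ.facet i
  face₁ i σ := σ.facet i
  char_face₀ i σ x := L.toricChar_facet i σ x 0 (by simp)
  char_face₁ i σ x := L.toricChar_facet i σ x 1 (by simp)
  char_corner {n} σ x hx := Subtype.ext (funext fun v => by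
    change _ = (1 : Circle)
    by_cases hv : v ∈ σ.verts
    · obtain ⟨j, rfl⟩ := σ.exists_vertex hv
      rw [toricChar_vertex]
      rcases hx j with h | h <;> simp [h]
    · exact L.toricChar_of_notMem σ x hv)
  existsUnique_cell y := by
    obtain ⟨n, σ, x, hx, rfl⟩ := L.exists_cell y
    exact ⟨⟨n, σ, x⟩, ⟨hx, rfl⟩, fun p hp => L.cell_unique _ _ _ _ hp.1 hx hp.2⟩
  isClosed_of_cells S hS := by
    have h : S = ⋃ τ : Finset V, ⋃ h : τ ∈ L.simplices,
        L.toricChar ⟨τ, h, rfl⟩ '' (L.toricChar ⟨τ, h, rfl⟩ ⁻¹' S) := by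
      refine Set.Subset.antisymm (fun y hy => ?_) ?_
      · obtain ⟨n, ⟨τ, h, rfl⟩, x, -, rfl⟩ := L.exists_cell y
        exact Set.mem_iUnion₂.mpr ⟨τ, h, x, hy, rfl⟩
      · exact Set.iUnion₂_subset fun τ h => Set.image_preimage_subset _ _
    rw [h]
    exact isClosed_iUnion_of_finite fun τ => isClosed_iUnion_of_finite fun h =>
      ((hS _ _).isCompact.image (L.toricChar _).continuous).isClosed

/-- `H^p(T_L, M)`, where `M` is a representation over `k` of `G_L = π₁(T_L)`. -/
abbrev ToricCohomology [Finite V] {k : Type w} [CommRing k] {M : Type*} [AddCommGroup M]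
    [Module k M] (ρ : Representation k L.ToricGroup M) (p : ℕ) :=
  L.toricCells.Cohomology ρ p

end AbstractSimplicialComplex

end

/-!
Write `Γ` for the abelianized fundamental group of the toric complex `T`, and `t v ∈ Γ` for the
class of the circle at the vertex `v`. Opposite facets of a cube of `T` are the same cell, so the
cellular cochain complex of `T` with coefficients in `A = k[Γ]` is the augmented simplicial cochain
complex of `L` in which the restriction along the vertex `v` is twisted by `x v = (t v)⁻¹ - 1`.

Winding numbers show that the `t v` are independent in `Γ`. Therefore the `x v` are commuting
injective operators whose images have complements spanned by group elements, namely the group rings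
of the kernels of the winding numbers, and the corresponding projections commute. Splitting `A`
along all vertices at once decomposes the cochain complex: each simplex `σ` and each group element
without winding around the vertices of `σ` contribute a copy of the augmented cochain complex of the
link of `σ`, shifted by `|σ|`. So `H^p(T, A)` is a direct sum of copies of the reduced cohomology of
the links of the simplices `σ` in degree `p - |σ| - 1`, in which every `σ` occurs.

It follows that vanishing and torsion-freeness can be tested on links. The dimension is detected by
the maximal simplices `σ`: their links have no vertex, so that the reduced cohomology of the link in
degree `-1`, which is `k`, is a summand of `H^|σ|(T, A)`.
-/

noncomputable section

/-! ### The winding number -/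

theorem zmultiplesHom_two_pi_injective :
    Function.Injective (zmultiplesHom ℝ (2 * Real.pi)) := fun m n h => by
  simpa [Real.pi_ne_zero] using h

/-- The deck transformations of `Circle.exp` form a group isomorphic to `ℤ`. -/
def intEquivZMultiplesTwoPi : ℤ ≃+ AddSubgroup.zmultiples (2 * Real.pi) :=
  AddMonoidHom.ofInjective zmultiplesHom_two_pi_injective

/-- The winding number of a loop in the circle, read off from the deck transformation that it
defines on the universal cover. -/
def windingNumber : FundamentalGroup Circle 1 →* Multiplicative ℤ :=
  (AddMonoidHom.toMultiplicative intEquivZMultiplesTwoPi.symm.toAddMonoidHom).comp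
    (MulOpposite.opMulEquiv.symm.toMonoidHom.comp
      (Circle.isAddQuotientCoveringMap_exp.fundamentalGroupToMulOpposite ⟨0, Circle.exp_zero⟩))

theorem windingNumber_eq_of_lift (γ : Path (1 : Circle) 1) (n : ℤ)
    (Γ : Path (0 : ℝ) (n * (2 * Real.pi))) (hΓ : ∀ t, Circle.exp (Γ t) = γ t) :
    windingNumber (FundamentalGroup.fromPath (Path.Homotopic.Quotient.mk γ)) =
      Multiplicative.ofAdd n := by
  have endpoint : Circle.exp (n * (2 * Real.pi)) = 1 := by
    rw [← Γ.target, hΓ, γ.target]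
  have deck : Circle.isAddQuotientCoveringMap_exp.fundamentalGroupToMulOpposite
      ⟨0, Circle.exp_zero⟩ (FundamentalGroup.fromPath (Path.Homotopic.Quotient.mk γ)) =
      MulOpposite.op (Multiplicative.ofAdd (intEquivZMultiplesTwoPi n)) := by
    rw [IsAddQuotientCoveringMap.fundamentalGroupToMulOpposite_apply_eq_Iff]
    rw [Circle.isCoveringMap_exp.monodromy_eq_of_map_eq (ex := ⟨0, Circle.exp_zero⟩)
      (ey := ⟨n * (2 * Real.pi), endpoint⟩) (γ := Path.Homotopic.Quotient.mk γ)
      (Path.Homotopic.Quotient.mk Γ)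
      (congrArg Path.Homotopic.Quotient.mk (Path.ext (funext hΓ)))]
    change n • (2 * Real.pi) + 0 = n * (2 * Real.pi)
    rw [add_zero, zsmul_eq_mul]
  rw [windingNumber, MonoidHom.comp_apply, MonoidHom.comp_apply, deck]
  exact congrArg Multiplicative.ofAdd (intEquivZMultiplesTwoPi.symm_apply_apply n)

/-! ### Loops in a toric complex -/

section ToricLoops

variable {V : Type u} (L : AbstractSimplicialComplex V)

/-- The coordinate function of the toric complex at `v`. -/
def toricCoord (v : V) : C(L.Toric, Circle) where
  toFun x := x.1 v
  continuous_toFun := (continuous_apply v).comp continuous_subtype_val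

theorem toricCoord_toricBase (v : V) : toricCoord L v L.toricBase = 1 := rfl

/-- The winding number of a loop in the toric complex around the circle factor at `v`. -/
def toricWinding (v : V) : Abelianization L.ToricGroup →* Multiplicative ℤ :=
  Abelianization.lift (windingNumber.comp
    (FundamentalGroup.mapOfEq (toricCoord L v) (toricCoord_toricBase L v)))

theorem toricWinding_eq_of_lift (v : V) (γ : Path L.toricBase L.toricBase) (n : ℤ)
    (Γ : Path (0 : ℝ) (n * (2 * Real.pi))) (hΓ : ∀ t, Circle.exp (Γ t) = (γ t).1 v) :
    toricWinding L v
      (Abelianization.of (FundamentalGroup.fromPath (Path.Homotopic.Quotient.mk γ))) =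
      Multiplicative.ofAdd n := by
  rw [toricWinding, Abelianization.lift_apply_of, MonoidHom.comp_apply,
    FundamentalGroup.mapOfEq_apply]
  exact windingNumber_eq_of_lift ((γ.map (toricCoord L v).continuous).cast
    (toricCoord_toricBase L v).symm (toricCoord_toricBase L v).symm) n Γ hΓ

variable [LinearOrder V]

/-- The `1`-cell of the toric complex at the vertex `v`. -/
def vertexCell (v : V) : L.Simplex 1 :=
  ⟨{v}, Or.inr (L.singleton_mem v), Finset.card_singleton v⟩

theorem vertex_vertexCell (v : V) : (vertexCell L v).vertex 0 = v :=
  Finset.mem_singleton.mp ((vertexCell L v).vertex_mem 0)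

variable [Finite V]

theorem toricCells_edgePath_apply {n : ℕ} (σ : L.Simplex n) (i : Fin n) (t : unitInterval) (v : V) :
    (L.toricCells.edgePath σ i t).1 v =
      if v = σ.vertex i then Circle.exp (2 * Real.pi * t) else 1 := by
  change (L.toricChar σ (Function.update (fun _ => 0) i t)).1 v = _
  by_cases hv : v ∈ σ.verts
  · obtain ⟨j, rfl⟩ := σ.exists_vertex hv
    rw [L.toricChar_vertex]
    rcases eq_or_ne j i with rfl | h
    · simp
    · simp [h, σ.vertex.injective.ne h]
  · rw [L.toricChar_of_notMem _ _ hv, if_neg (ne_of_mem_of_not_mem (σ.vertex_mem i) hv).symm]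

/-- The homology class of the circle of the toric complex at the vertex `v`. -/
def toricLoop (v : V) : Abelianization L.ToricGroup :=
  Abelianization.of (L.toricCells.edge (vertexCell L v) 0)

theorem abelianization_of_edge {n : ℕ} (σ : L.Simplex n) (i : Fin n) :
    Abelianization.of (L.toricCells.edge σ i) = toricLoop L (σ.vertex i) := by
  have same_path :
      L.toricCells.edgePath σ i = L.toricCells.edgePath (vertexCell L (σ.vertex i)) 0 :=
    Path.ext <| funext fun t => Subtype.ext <| funext fun v => by
      rw [toricCells_edgePath_apply, toricCells_edgePath_apply, vertex_vertexCell]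
  simp only [toricLoop, CubicalStructure.edge, same_path]

theorem toricWinding_toricLoop_self (v : V) :
    toricWinding L v (toricLoop L v) = Multiplicative.ofAdd 1 :=
  toricWinding_eq_of_lift L v _ 1
    { toFun := fun t => 2 * Real.pi * t
      continuous_toFun := by fun_prop
      source' := by simp
      target' := by simp }
    fun t => by
      rw [toricCells_edgePath_apply, vertex_vertexCell, if_pos rfl]
      rfl

theorem toricWinding_toricLoop_of_ne {v w : V} (h : v ≠ w) :
    toricWinding L v (toricLoop L w) = 1 :=
  toricWinding_eq_of_lift L v _ 0 ((Path.refl 0).cast rfl (by simp)) fun t => by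
    rw [toricCells_edgePath_apply, vertex_vertexCell, if_neg h]
    exact Circle.exp_zero

end ToricLoops

/-! ### Split families -/

/-- A family of commuting elements `x v` of a ring with left inverses `y v` that commute with each
other and with the `x w` for `w ≠ v`. The idempotents `1 - x v * y v` then split the ring along all
indices simultaneously. -/
structure IsSplitFamily {V E : Type*} [Ring E] (x y : V → E) : Prop where
  left_inv : ∀ v, y v * x v = 1
  comm_x : ∀ v w, Commute (x v) (x w)
  comm_y : ∀ v w, Commute (y v) (y w)
  comm_xy : ∀ v w, v ≠ w → Commute (x v) (y w)

namespace IsSplitFamily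

variable {V E : Type*} [Ring E] {x y p : V → E}

theorem of_isLeftRegular (comm_x : ∀ v w, Commute (x v) (x w)) (reg : ∀ v, IsLeftRegular (x v))
    (comm_p : ∀ v w, Commute (p v) (p w)) (comm_xp : ∀ v w, v ≠ w → Commute (x v) (p w))
    (p_mul_x : ∀ v, p v * x v = 0) (x_mul_y : ∀ v, x v * y v = 1 - p v) : IsSplitFamily x y := by
  have comm_xq (v w : V) (hvw : v ≠ w) : Commute (x v) (1 - p w) :=
    (Commute.one_right _).sub_right (comm_xp v w hvw)
  have comm_q (v w : V) : Commute (1 - p v) (1 - p w) :=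
    ((Commute.one_right _).sub_right ((Commute.one_left _).sub_left (comm_p v w)))
  refine ⟨fun v => reg v ?_, comm_x, fun v w => ?_, fun v w hvw => reg w ?_⟩
  · simp only [← mul_assoc, x_mul_y, sub_mul, p_mul_x, one_mul, mul_one, sub_zero]
  · rcases eq_or_ne v w with rfl | hvw
    · exact Commute.refl _
    refine ((reg v).mul (reg w)) ?_
    calc x v * x w * (y v * y w) = x w * (x v * y v) * y w := by
          rw [(comm_x v w).eq]; simp only [mul_assoc]
      _ = (1 - p v) * (1 - p w) := by
          rw [x_mul_y, (comm_xq w v hvw.symm).eq, mul_assoc, x_mul_y]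
      _ = x v * (x w * y w) * y v := by
          rw [(comm_q v w).eq, x_mul_y, (comm_xq v w hvw).eq, mul_assoc, x_mul_y]
      _ = x v * x w * (y w * y v) := by simp only [mul_assoc]
  · calc x w * (x v * y w) = x v * (x w * y w) := by
          rw [← mul_assoc, (comm_x w v).eq, mul_assoc]
      _ = x w * (y w * x v) := by rw [x_mul_y, (comm_xq v w hvw).eq, ← x_mul_y, mul_assoc]

/-- The idempotent complementary to `x v * y v`. -/
def proj (x y : V → E) (v : V) : E := 1 - x v * y v

variable (h : IsSplitFamily x y)
include h

theorem proj_mul_x (v : V) : proj x y v * x v = 0 := by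
  rw [proj, sub_mul, mul_assoc, h.left_inv, one_mul, mul_one, sub_self]

theorem y_mul_proj (v : V) : y v * proj x y v = 0 := by
  rw [proj, mul_sub, ← mul_assoc, h.left_inv, one_mul, mul_one, sub_self]

theorem proj_mul_proj (v : V) : proj x y v * proj x y v = proj x y v := by
  nth_rw 1 [proj]
  rw [sub_mul, one_mul, mul_assoc, h.y_mul_proj, mul_zero, sub_zero]

theorem comm_x_proj {v w : V} (hvw : v ≠ w) : Commute (x v) (proj x y w) :=
  (Commute.one_right _).sub_right ((h.comm_x v w).mul_right (h.comm_xy v w hvw))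

theorem comm_y_proj {v w : V} (hvw : v ≠ w) : Commute (y v) (proj x y w) :=
  (Commute.one_right _).sub_right ((h.comm_xy w v hvw.symm).symm.mul_right (h.comm_y v w))

theorem comm_proj (v w : V) : Commute (proj x y v) (proj x y w) := by
  rcases eq_or_ne v w with rfl | hvw
  · exact Commute.refl _
  · exact (Commute.one_left _).sub_left ((h.comm_x_proj hvw).mul_left (h.comm_y_proj hvw))

/-- The product of the `x v` over a finite set. -/
def xProd (s : Finset V) : E := s.noncommProd x fun v _ w _ _ => h.comm_x v w

/-- The product of the `y v` over a finite set. -/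
def yProd (s : Finset V) : E := s.noncommProd y fun v _ w _ _ => h.comm_y v w

/-- The product of the idempotents `1 - x v * y v` over a finite set. -/
def projProd (s : Finset V) : E := s.noncommProd (proj x y) fun v _ w _ _ => h.comm_proj v w

theorem comm_x_yProd {v : V} {s : Finset V} (hv : v ∉ s) : Commute (x v) (h.yProd s) :=
  Finset.noncommProd_commute _ _ _ _ fun w hw => h.comm_xy v w (ne_of_mem_of_not_mem hw hv).symm

theorem comm_y_xProd {v : V} {s : Finset V} (hv : v ∉ s) : Commute (y v) (h.xProd s) :=
  Finset.noncommProd_commute _ _ _ _ fun w hw =>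
    (h.comm_xy w v (ne_of_mem_of_not_mem hw hv)).symm

theorem comm_proj_yProd {v : V} {s : Finset V} (hv : v ∉ s) :
    Commute (proj x y v) (h.yProd s) :=
  Finset.noncommProd_commute _ _ _ _ fun _ hw =>
    (h.comm_y_proj (ne_of_mem_of_not_mem hw hv)).symm

@[simp]
theorem xProd_empty : h.xProd ∅ = 1 := rfl

@[simp]
theorem yProd_empty : h.yProd ∅ = 1 := rfl

@[simp]
theorem projProd_empty : h.projProd ∅ = 1 := rfl

variable {v : V} {r s t r' t' : Finset V}

theorem xProd_insert [DecidableEq V] (hv : v ∉ s) : h.xProd (insert v s) = x v * h.xProd s :=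
  Finset.noncommProd_insert_of_notMem _ _ _ _ hv

theorem yProd_insert [DecidableEq V] (hv : v ∉ s) : h.yProd (insert v s) = h.yProd s * y v :=
  Finset.noncommProd_insert_of_notMem' _ _ _ _ hv

theorem projProd_insert [DecidableEq V] (hv : v ∉ s) :
    h.projProd (insert v s) = h.projProd s * proj x y v :=
  Finset.noncommProd_insert_of_notMem' _ _ _ _ hv

theorem yProd_mul_xProd (s : Finset V) : h.yProd s * h.xProd s = 1 := by
  classical
  induction s using Finset.induction_on with
  | empty => simp
  | insert v s hv ih =>
    rw [h.yProd_insert hv, h.xProd_insert hv, mul_assoc, ← mul_assoc (y v), h.left_inv, one_mul,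
      ih]

theorem x_mul_xProd_erase [DecidableEq V] (hv : v ∈ s) : x v * h.xProd (s.erase v) = h.xProd s :=
  Finset.mul_noncommProd_erase _ hv _ _

theorem yProd_erase_mul_y [DecidableEq V] (hv : v ∈ s) : h.yProd (s.erase v) * y v = h.yProd s :=
  Finset.noncommProd_erase_mul _ hv _ _

theorem yProd_mul_x [DecidableEq V] (hv : v ∈ s) : h.yProd s * x v = h.yProd (s.erase v) := by
  rw [← h.yProd_erase_mul_y hv, mul_assoc, h.left_inv, mul_one]

theorem projProd_erase_mul_proj [DecidableEq V] (hv : v ∈ s) :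
    h.projProd (s.erase v) * proj x y v = h.projProd s :=
  Finset.noncommProd_erase_mul _ hv _ _

theorem proj_mul_projProd_erase [DecidableEq V] (hv : v ∈ s) :
    proj x y v * h.projProd (s.erase v) = h.projProd s :=
  Finset.mul_noncommProd_erase _ hv _ _

theorem projProd_mul_x (hv : v ∈ s) : h.projProd s * x v = 0 := by
  classical
  rw [← h.projProd_erase_mul_proj hv, mul_assoc, h.proj_mul_x, mul_zero]

theorem y_mul_projProd (hv : v ∈ s) : y v * h.projProd s = 0 := by
  classical
  rw [← h.proj_mul_projProd_erase hv, ← mul_assoc, h.y_mul_proj, zero_mul]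

theorem proj_mul_projProd (hv : v ∈ s) : proj x y v * h.projProd s = h.projProd s := by
  classical
  rw [← h.proj_mul_projProd_erase hv, ← mul_assoc, h.proj_mul_proj]

theorem projProd_mul_yProd_mul_x (hv : v ∈ r) (hrt : Disjoint r t) :
    h.projProd r * h.yProd t * x v = 0 := by
  rw [mul_assoc, ← (h.comm_x_yProd (Finset.disjoint_left.mp hrt hv)).eq, ← mul_assoc,
    h.projProd_mul_x hv, zero_mul]

theorem sum_xProd_mul_projProd_mul_yProd [DecidableEq V] (s : Finset V) :
    ∑ r ∈ s.powerset, h.xProd (s \ r) * h.projProd r * h.yProd (s \ r) = 1 := by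
  induction s using Finset.induction_on with
  | empty => simp
  | insert v s hv ih =>
    have notMem_left (r) (hr : r ∈ s.powerset) : v ∉ r :=
      fun h' => hv (Finset.mem_powerset.mp hr h')
    have notMem_right (r) : v ∉ s \ r := fun h' => hv (Finset.mem_sdiff.mp h').1
    have without_v (r) (hr : r ∈ s.powerset) :
        h.xProd (insert v s \ r) * h.projProd r * h.yProd (insert v s \ r) =
          x v * (h.xProd (s \ r) * h.projProd r * h.yProd (s \ r)) * y v := by
      rw [Finset.insert_sdiff_of_notMem _ (notMem_left r hr), h.xProd_insert (notMem_right r),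
        h.yProd_insert (notMem_right r)]
      simp only [mul_assoc]
    have with_v (r) (hr : r ∈ s.powerset) :
        h.xProd (insert v s \ insert v r) * h.projProd (insert v r) *
            h.yProd (insert v s \ insert v r) =
          h.xProd (s \ r) * h.projProd r * h.yProd (s \ r) * proj x y v := by
      have sdiff_eq : insert v s \ insert v r = s \ r := by
        rw [Finset.insert_sdiff_insert, Finset.sdiff_insert,
          Finset.erase_eq_of_notMem (notMem_right r)]
      rw [sdiff_eq, h.projProd_insert (notMem_left r hr)]
      simp only [mul_assoc, (h.comm_proj_yProd (notMem_right r)).eq]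
    rw [Finset.sum_powerset_insert hv, Finset.sum_congr rfl without_v, Finset.sum_congr rfl with_v,
      ← Finset.sum_mul, ← Finset.sum_mul, ← Finset.mul_sum, ih, proj, mul_one, one_mul,
      add_sub_cancel]

theorem projProd_mul_yProd_mul_xProd_mul_projProd [DecidableEq V] (hrt : Disjoint r t)
    (hrt' : Disjoint r' t') (union_eq : r ∪ t = r' ∪ t') (hne : r' ≠ r) :
    h.projProd r' * h.yProd t' * h.xProd t * h.projProd r = 0 := by
  by_cases hsub : r' ⊆ r
  · obtain ⟨v, hv, hv'⟩ := Finset.exists_of_ssubset (hsub.ssubset_of_ne hne)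
    have hvt' : v ∈ t' :=
      (Finset.mem_union.mp (union_eq ▸ Finset.mem_union_left t hv)).resolve_left hv'
    have hvt : v ∉ t := Finset.disjoint_left.mp hrt hv
    rw [← h.yProd_erase_mul_y hvt']
    simp only [mul_assoc]
    rw [← mul_assoc (y v), (h.comm_y_xProd hvt).eq, mul_assoc, h.y_mul_projProd hv]
    simp only [mul_zero]
  · obtain ⟨v, hv, hv'⟩ := Finset.not_subset.mp hsub
    have hvt : v ∈ t :=
      (Finset.mem_union.mp (union_eq ▸ Finset.mem_union_left t' hv)).resolve_left hv'
    rw [← h.x_mul_xProd_erase hvt, ← mul_assoc, h.projProd_mul_yProd_mul_x hv hrt',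
      zero_mul, zero_mul]

end IsSplitFamily

/-! ### Cochains on all finite subsets -/

section Cochains

variable {V k A : Type*} [LinearOrder V] [CommRing k] [AddCommGroup A] [Module k A]

/-- The sign with which the facet of `s` opposite to `v` occurs in the boundary of `s`. -/
def vertexSign (k : Type*) [CommRing k] (s : Finset V) (v : V) : k :=
  (-1) ^ (s.filter (· < v)).card

theorem vertexSign_mul_self (s : Finset V) (v : V) :
    vertexSign k s v * vertexSign k s v = 1 := by
  rw [vertexSign, ← mul_pow, neg_one_mul, neg_neg, one_pow]

theorem vertexSign_union {r t : Finset V} (hrt : Disjoint r t) (v : V) :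
    vertexSign k (r ∪ t) v = vertexSign k r v * vertexSign k t v := by
  rw [vertexSign, Finset.filter_union,
    Finset.card_union_of_disjoint (Finset.disjoint_filter_filter hrt), pow_add]
  rfl

/-- The sign of the shuffle that sorts the concatenation of `r` and `t`. -/
def shuffleSign (k : Type*) [CommRing k] (r t : Finset V) : k :=
  ∏ v ∈ t, vertexSign k r v

theorem shuffleSign_mul_self (r t : Finset V) : shuffleSign k r t * shuffleSign k r t = 1 := by
  rw [shuffleSign, ← Finset.prod_mul_distrib]
  exact Finset.prod_eq_one fun v _ => vertexSign_mul_self r v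

theorem vertexSign_mul_shuffleSign_erase (r : Finset V) {t : Finset V} {v : V} (hv : v ∈ t) :
    vertexSign k r v * shuffleSign k r (t.erase v) = shuffleSign k r t :=
  Finset.mul_prod_erase t _ hv

/-- The coboundary on `A`-valued cochains on all finite subsets of `V`, in which the restriction to
the facet opposite to `v` is twisted by the endomorphism `x v`. -/
def twistedCoboundary (x : V → Module.End k A) : (Finset V → A) →ₗ[k] (Finset V → A) :=
  LinearMap.pi fun s => ∑ v ∈ s, vertexSign k s v •
    (x v).comp (LinearMap.proj (s.erase v) : (Finset V → A) →ₗ[k] A)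

theorem twistedCoboundary_apply (x : V → Module.End k A) (F : Finset V → A) (s : Finset V) :
    twistedCoboundary x F s = ∑ v ∈ s, vertexSign k s v • x v (F (s.erase v)) := by
  simp [twistedCoboundary]

variable {x y : V → Module.End k A} (h : IsSplitFamily x y)

/-- Spreads a scalar cochain on the subsets disjoint from `r` to an `A`-valued cochain on the
subsets containing `r`, along the vector `a`. -/
def linkIncl (r : Finset V) (a : A) : (Finset V → k) →ₗ[k] (Finset V → A) :=
  LinearMap.pi fun s => if r ⊆ s then
    shuffleSign k r (s \ r) •
      (LinearMap.proj (s \ r) : (Finset V → k) →ₗ[k] k).smulRight (h.xProd (s \ r) a)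
  else 0

/-- Extracts from an `A`-valued cochain a scalar cochain on the subsets disjoint from `r`, by
applying the functional `φ`. Only the values on those subsets are meaningful. -/
def linkProj (r : Finset V) (φ : Module.Dual k A) : (Finset V → A) →ₗ[k] (Finset V → k) :=
  LinearMap.pi fun t => shuffleSign k r t •
    (φ ∘ₗ (h.projProd r * h.yProd t)).comp (LinearMap.proj (r ∪ t) : (Finset V → A) →ₗ[k] A)

theorem linkIncl_apply_of_subset {r s : Finset V} (hrs : r ⊆ s) (a : A) (f : Finset V → k) :
    linkIncl h r a f s = (shuffleSign k r (s \ r) * f (s \ r)) • h.xProd (s \ r) a := by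
  simp [linkIncl, hrs, mul_smul]

theorem linkIncl_apply_union {r t : Finset V} (hrt : Disjoint r t) (a : A) (f : Finset V → k) :
    linkIncl h r a f (r ∪ t) = (shuffleSign k r t * f t) • h.xProd t a := by
  rw [linkIncl_apply_of_subset h Finset.subset_union_left, Finset.union_sdiff_cancel_left hrt]

theorem linkIncl_apply_of_not_subset {r s : Finset V} (hrs : ¬ r ⊆ s) (a : A) (f : Finset V → k) :
    linkIncl h r a f s = 0 := by
  simp [linkIncl, hrs]

theorem linkProj_apply (r : Finset V) (φ : Module.Dual k A) (F : Finset V → A) (t : Finset V) :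
    linkProj h r φ F t = shuffleSign k r t * φ ((h.projProd r * h.yProd t) (F (r ∪ t))) := rfl

theorem erase_union_of_disjoint {r t : Finset V} (hrt : Disjoint r t) {v : V} (hv : v ∈ t) :
    (r ∪ t).erase v = r ∪ t.erase v := by
  rw [Finset.erase_union_distrib, Finset.erase_eq_of_notMem (Finset.disjoint_right.mp hrt hv)]

theorem twistedCoboundary_linkIncl (r : Finset V) (a : A) (f : Finset V → k) :
    twistedCoboundary x (linkIncl h r a f) =
      linkIncl h r a (twistedCoboundary (1 : V → Module.End k k) f) := by
  funext s
  rw [twistedCoboundary_apply]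
  by_cases hrs : r ⊆ s
  · obtain ⟨t, hrt, rfl⟩ : ∃ t, Disjoint r t ∧ r ∪ t = s :=
      ⟨s \ r, Finset.disjoint_sdiff, Finset.union_sdiff_of_subset hrs⟩
    have vanish (v) (hv : v ∈ r) : linkIncl h r a f ((r ∪ t).erase v) = 0 :=
      linkIncl_apply_of_not_subset h (fun hsub => Finset.notMem_erase v _ (hsub hv)) a f
    rw [Finset.sum_union hrt,
      Finset.sum_eq_zero fun v hv => by rw [vanish v hv, map_zero, smul_zero],
      zero_add, linkIncl_apply_union h hrt, twistedCoboundary_apply, Finset.mul_sum,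
      Finset.sum_smul]
    refine Finset.sum_congr rfl fun v hv => ?_
    rw [erase_union_of_disjoint hrt hv, linkIncl_apply_union h (hrt.mono_right (t.erase_subset v)),
      map_smul, ← Module.End.mul_apply, h.x_mul_xProd_erase hv, smul_smul,
      vertexSign_union hrt, ← vertexSign_mul_shuffleSign_erase r hv, Pi.one_apply,
      Module.End.one_apply, smul_eq_mul]
    ring_nf
  · rw [linkIncl_apply_of_not_subset h hrs]
    refine Finset.sum_eq_zero fun v _ => ?_
    rw [linkIncl_apply_of_not_subset h fun hsub => hrs (hsub.trans (Finset.erase_subset _ _)),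
      map_zero, smul_zero]

theorem twistedCoboundary_linkProj (φ : Module.Dual k A) (F : Finset V → A) {r t : Finset V}
    (hrt : Disjoint r t) :
    twistedCoboundary (1 : V → Module.End k k) (linkProj h r φ F) t =
      linkProj h r φ (twistedCoboundary x F) t := by
  have vanish : (h.projProd r * h.yProd t)
      (∑ v ∈ r, vertexSign k (r ∪ t) v • x v (F ((r ∪ t).erase v))) = 0 := by
    rw [map_sum]
    refine Finset.sum_eq_zero fun v hv => ?_
    rw [map_smul, ← Module.End.mul_apply, h.projProd_mul_yProd_mul_x hv hrt, LinearMap.zero_apply,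
      smul_zero]
  rw [linkProj_apply, twistedCoboundary_apply, twistedCoboundary_apply, Finset.sum_union hrt,
    map_add, vanish, zero_add, map_sum, map_sum, Finset.mul_sum]
  refine Finset.sum_congr rfl fun v hv => ?_
  rw [map_smul, map_smul, ← Module.End.mul_apply _ (x v), mul_assoc, h.yProd_mul_x hv, smul_eq_mul,
    smul_eq_mul, erase_union_of_disjoint hrt hv, Pi.one_apply, Module.End.one_apply,
    linkProj_apply, vertexSign_union hrt, ← vertexSign_mul_shuffleSign_erase r hv]
  linear_combination -(vertexSign k t v * shuffleSign k r (t.erase v) *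
    φ ((h.projProd r * h.yProd (t.erase v)) (F (r ∪ t.erase v)))) * vertexSign_mul_self (k := k) r v

theorem linkProj_linkIncl_apply {r t : Finset V} (hrt : Disjoint r t) {a : A}
    (φ : Module.Dual k A) (ha : h.projProd r a = a) (f : Finset V → k) :
    linkProj h r φ (linkIncl h r a f) t = φ a * f t := by
  have cancel : (h.projProd r * h.yProd t) (h.xProd t a) = a := by
    rw [← Module.End.mul_apply, mul_assoc, h.yProd_mul_xProd, mul_one, ha]
  rw [linkProj_apply, linkIncl_apply_union h hrt, map_smul, cancel, map_smul, smul_eq_mul]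
  linear_combination f t * φ a * shuffleSign_mul_self (k := k) r t

theorem linkProj_linkIncl_apply_of_ne {r r' t' : Finset V} (hrt' : Disjoint r' t') (hne : r' ≠ r)
    {a : A} (φ : Module.Dual k A) (ha : h.projProd r a = a) (f : Finset V → k) :
    linkProj h r' φ (linkIncl h r a f) t' = 0 := by
  rw [linkProj_apply]
  by_cases hsub : r ⊆ r' ∪ t'
  · rw [linkIncl_apply_of_subset h hsub, map_smul, ← ha]
    simp only [← Module.End.mul_apply, ← mul_assoc]
    rw [h.projProd_mul_yProd_mul_xProd_mul_projProd Finset.disjoint_sdiff hrt'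
      (Finset.union_sdiff_of_subset hsub) hne, LinearMap.zero_apply, smul_zero, map_zero, mul_zero]
  · rw [linkIncl_apply_of_not_subset h hsub, map_zero, map_zero, mul_zero]

theorem exists_finset_sum_coord_smul_eq {Γ ι : Type*} [Finite ι] (b : Module.Basis Γ k A)
    (a : ι → A) : ∃ S : Finset Γ, ∀ i, ∑ γ ∈ S, b.coord γ (a i) • b γ = a i := by
  classical
  have := Fintype.ofFinite ι
  refine ⟨Finset.univ.biUnion fun i => (b.repr (a i)).support, fun i => ?_⟩
  refine Eq.trans ?_ (b.linearCombination_repr (a i))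
  refine (Finset.sum_subset (Finset.subset_biUnion_of_mem _ (Finset.mem_univ i))
    fun γ _ hγ => ?_).symm
  rw [b.coord_apply, Finsupp.notMem_support_iff.mp hγ, zero_smul]

theorem exists_sum_linkIncl_linkProj_eq [Fintype V] {Γ : Type*} (b : Module.Basis Γ k A)
    (F : Finset V → A) :
    ∃ S : Finset Γ, ∑ r, ∑ γ ∈ S, linkIncl h r (b γ) (linkProj h r (b.coord γ) F) = F := by
  obtain ⟨S, hS⟩ := exists_finset_sum_coord_smul_eq b fun q : Finset V × Finset V =>
    h.projProd q.1 (h.yProd (q.2 \ q.1) (F q.2))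
  refine ⟨S, funext fun s => ?_⟩
  have term (r) (hr : r ∈ s.powerset) :
      ∑ γ ∈ S, linkIncl h r (b γ) (linkProj h r (b.coord γ) F) s =
        (h.xProd (s \ r) * h.projProd r * h.yProd (s \ r)) (F s) := by
    have hrs := Finset.mem_powerset.mp hr
    refine Eq.trans ?_ (congrArg (h.xProd (s \ r)) (hS (r, s)))
    rw [map_sum]
    refine Finset.sum_congr rfl fun γ _ => ?_
    rw [linkIncl_apply_of_subset h hrs, linkProj_apply, Finset.union_sdiff_of_subset hrs,
      ← mul_assoc, shuffleSign_mul_self, one_mul, map_smul]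
    rfl
  simp only [Finset.sum_apply]
  rw [← Finset.sum_subset s.powerset.subset_univ fun r _ hr => Finset.sum_eq_zero fun γ _ =>
      linkIncl_apply_of_not_subset h (mt Finset.mem_powerset.mpr hr) _ _,
    Finset.sum_congr rfl term, ← LinearMap.sum_apply, h.sum_xProd_mul_projProd_mul_yProd,
    Module.End.one_apply]

end Cochains

section AdaptedBasis

variable {V k A Γ : Type*} [CommRing k] [AddCommGroup A] [Module k A]

/-- A basis `b` is adapted to the family of idempotents `1 - x v * y v` if each of them projects
onto the span of the basis vectors with index in `fix v`. -/
def IsAdaptedBasis (b : Module.Basis Γ k A) (x y : V → Module.End k A)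
    (fix : V → Set Γ) : Prop :=
  ∀ v, LinearMap.range (IsSplitFamily.proj x y v) = Submodule.span k (b '' fix v)

variable {x y : V → Module.End k A} (h : IsSplitFamily x y) {b : Module.Basis Γ k A}
  {fix : V → Set Γ} (hb : IsAdaptedBasis b x y fix)
include hb

theorem IsAdaptedBasis.projProd_apply_basis {r : Finset V} {γ : Γ} (hγ : ∀ v ∈ r, γ ∈ fix v) :
    h.projProd r (b γ) = b γ := by
  classical
  induction r using Finset.induction_on with
  | empty => simp
  | insert v r hv ih =>
    obtain ⟨a, ha⟩ : b γ ∈ LinearMap.range (IsSplitFamily.proj x y v) :=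
      hb v ▸ Submodule.subset_span ⟨γ, hγ v (Finset.mem_insert_self v r), rfl⟩
    have fixed : IsSplitFamily.proj x y v (b γ) = b γ := by
      rw [← ha, ← Module.End.mul_apply, h.proj_mul_proj]
    rw [h.projProd_insert hv, Module.End.mul_apply, fixed,
      ih fun w hw => hγ w (Finset.mem_insert_of_mem hw)]

theorem IsAdaptedBasis.coord_projProd_eq_zero {r : Finset V} {γ : Γ} (hγ : ¬ ∀ v ∈ r, γ ∈ fix v)
    (a : A) : b.coord γ (h.projProd r a) = 0 := by
  push Not at hγ
  obtain ⟨v, hv, hγv⟩ := hγ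
  have mem_range : h.projProd r a ∈ LinearMap.range (IsSplitFamily.proj x y v) :=
    ⟨h.projProd r a, by rw [← Module.End.mul_apply, h.proj_mul_projProd hv]⟩
  rw [hb v, b.mem_span_image] at mem_range
  exact Finsupp.notMem_support_iff.mp fun hmem => hγv (mem_range hmem)

end AdaptedBasis

/-! ### Group rings -/

section Retraction

variable {Γ : Type*} [CommGroup Γ] {t t' : Γ} {ω ω' : Γ →* Multiplicative ℤ}

/-- The endomorphism of `Γ` that divides `γ` by `t ^ ω γ`. If `ω t` is the generator of
`Multiplicative ℤ`, it is the retraction onto the kernel of `ω` that kills `t`. -/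
def kernelRetraction (t : Γ) (ω : Γ →* Multiplicative ℤ) : Γ →* Γ :=
  MonoidHom.id Γ / (zpowersHom Γ t).comp ω

theorem kernelRetraction_apply (t : Γ) (ω : Γ →* Multiplicative ℤ) (γ : Γ) :
    kernelRetraction t ω γ = γ / t ^ (ω γ).toAdd := rfl

theorem kernelRetraction_of_mem_ker {γ : Γ} (hγ : ω γ = 1) : kernelRetraction t ω γ = γ := by
  rw [kernelRetraction_apply, hγ, toAdd_one, zpow_zero, div_one]

theorem kernelRetraction_self (ht : ω t = Multiplicative.ofAdd 1) :
    kernelRetraction t ω t = 1 := by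
  rw [kernelRetraction_apply, ht, toAdd_ofAdd, zpow_one, div_self']

theorem apply_kernelRetraction (ht : ω t = Multiplicative.ofAdd 1) (γ : Γ) :
    ω (kernelRetraction t ω γ) = 1 := by
  rw [kernelRetraction_apply, map_div, map_zpow, ht, ← ofAdd_zsmul, smul_eq_mul, mul_one,
    ofAdd_toAdd, div_self']

theorem range_kernelRetraction (ht : ω t = Multiplicative.ofAdd 1) :
    Set.range (kernelRetraction t ω) = {γ | ω γ = 1} :=
  Set.Subset.antisymm (Set.range_subset_iff.mpr (apply_kernelRetraction ht))
    fun _ hγ => ⟨_, kernelRetraction_of_mem_ker hγ⟩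

theorem kernelRetraction_comm (h : ω t' = 1) (h' : ω' t = 1) :
    (kernelRetraction t ω).comp (kernelRetraction t' ω') =
      (kernelRetraction t' ω').comp (kernelRetraction t ω) := by
  ext γ
  rw [MonoidHom.comp_apply, MonoidHom.comp_apply, kernelRetraction_apply t' ω' γ, map_div, map_zpow,
    kernelRetraction_of_mem_ker h, kernelRetraction_apply t ω γ, map_div, map_zpow,
    kernelRetraction_of_mem_ker h', kernelRetraction_apply t' ω' γ, div_right_comm]

theorem injective_zpow_of_apply_eq_ofAdd_one (ht : ω t = Multiplicative.ofAdd 1) :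
    Function.Injective (t ^ · : ℤ → Γ) := fun m n hmn => by
  simpa [ht, ← ofAdd_zsmul] using congrArg ω hmn

end Retraction

section GroupRing

open MonoidAlgebra

variable (k : Type*) {Γ : Type*} [CommRing k] [CommGroup Γ]

/-- Multiplication by `t⁻¹ - 1` on the group ring. It is the coboundary operator along an edge whose
monodromy is `t`, since `CubicalStructure.coboundary` transports backwards along the edge. -/
def invSubOne (t : Γ) : Module.End k (MonoidAlgebra k Γ) :=
  LinearMap.mulLeft k (of k Γ t⁻¹ - 1)

theorem invSubOne_apply (t : Γ) (a : MonoidAlgebra k Γ) :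
    invSubOne k t a = (of k Γ t⁻¹ - 1) * a := rfl

theorem invSubOne_comm (t t' : Γ) : Commute (invSubOne k t) (invSubOne k t') :=
  LinearMap.ext fun _ => mul_left_comm _ _ _

variable {k} in
theorem eq_zero_of_of_inv_mul_eq_self {t : Γ} (ht : Function.Injective (t ^ · : ℤ → Γ))
    {a : MonoidAlgebra k Γ} (ha : of k Γ t⁻¹ * a = a) : a = 0 := by
  have shift (γ : Γ) : a.coeff (t * γ) = a.coeff γ := by
    conv_rhs => rw [← ha]
    rw [of_apply, coeff_single_mul_apply, one_mul, inv_inv]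
  have shift_zpow (n : ℤ) (γ : Γ) : a.coeff (t ^ n * γ) = a.coeff γ := by
    induction n using Int.induction_on with
    | zero => rw [zpow_zero, one_mul]
    | succ n ih => rw [zpow_add_one, mul_comm (t ^ _), mul_assoc, shift, ih]
    | pred n ih => rw [← ih, ← shift, ← mul_assoc, ← zpow_one_add, add_sub_cancel]
  ext γ
  by_contra hγ
  refine Set.infinite_of_injective_forall_mem (s := a.coeff.support)
    (f := fun n : ℤ => t ^ n * γ) (fun m n hmn => ht (mul_right_cancel hmn)) (fun n => ?_)
    a.coeff.support.finite_toSet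
  rw [Finset.mem_coe, Finsupp.mem_support_iff, shift_zpow]
  exact hγ

theorem isLeftRegular_invSubOne {t : Γ} (ht : Function.Injective (t ^ · : ℤ → Γ)) :
    IsLeftRegular (invSubOne k t) := by
  have injective : Function.Injective (invSubOne k t) := by
    refine (injective_iff_map_eq_zero _).mpr fun a ha => eq_zero_of_of_inv_mul_eq_self ht ?_
    rwa [invSubOne_apply, sub_mul, one_mul, sub_eq_zero] at ha
  exact fun f g hfg => LinearMap.ext fun a => injective (LinearMap.congr_fun hfg a)

theorem of_inv_sub_one_dvd {t γ : Γ} (hγ : γ ∈ Subgroup.zpowers t) :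
    of k Γ t⁻¹ - 1 ∣ of k Γ γ - 1 := by
  let toQuotient : Γ →* MonoidAlgebra k Γ ⧸ Ideal.span {of k Γ t⁻¹ - 1} :=
    (Ideal.Quotient.mk _).toMonoidHom.comp (of k Γ)
  have mem_ker (γ : Γ) : γ ∈ toQuotient.ker ↔ of k Γ t⁻¹ - 1 ∣ of k Γ γ - 1 := by
    rw [← Ideal.mem_span_singleton, ← Ideal.Quotient.mk_eq_mk_iff_sub_mem]
    rfl
  rw [← mem_ker]
  exact Subgroup.zpowers_le.mpr (inv_mem_iff.mp ((mem_ker _).mpr dvd_rfl)) hγ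

theorem exists_invSubOne_apply_eq (t : Γ) (ω : Γ →* Multiplicative ℤ) (γ : Γ) :
    ∃ a, invSubOne k t a = of k Γ γ - of k Γ (kernelRetraction t ω γ) := by
  obtain ⟨c, hc⟩ := of_inv_sub_one_dvd k (Subgroup.zpow_mem_zpowers t (ω γ).toAdd)
  refine ⟨of k Γ (kernelRetraction t ω γ) * c, ?_⟩
  rw [invSubOne_apply, mul_left_comm, ← hc, mul_sub, mul_one, ← map_mul,
    kernelRetraction_apply, div_mul_cancel]

/-- The projection of the group ring onto the group ring of the kernel of `ω` induced by
`kernelRetraction`. -/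
def kernelProj (t : Γ) (ω : Γ →* Multiplicative ℤ) : Module.End k (MonoidAlgebra k Γ) :=
  (mapDomainAlgHom k k (kernelRetraction t ω)).toLinearMap

variable {t t' : Γ} {ω ω' : Γ →* Multiplicative ℤ}

theorem kernelProj_of (t : Γ) (ω : Γ →* Multiplicative ℤ) (γ : Γ) :
    kernelProj k t ω (of k Γ γ) = of k Γ (kernelRetraction t ω γ) :=
  mapDomain_single

theorem kernelProj_invSubOne (a : MonoidAlgebra k Γ) :
    kernelProj k t ω (invSubOne k t' a) =
      (of k Γ (kernelRetraction t ω t')⁻¹ - 1) * kernelProj k t ω a := by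
  rw [← map_inv, ← kernelProj_of, invSubOne_apply]
  simp only [kernelProj, AlgHom.toLinearMap_apply, map_mul, map_sub, map_one]

theorem kernelProj_mul_invSubOne_self (ht : ω t = Multiplicative.ofAdd 1) :
    kernelProj k t ω * invSubOne k t = 0 := by
  refine LinearMap.ext fun a => ?_
  rw [Module.End.mul_apply, kernelProj_invSubOne, kernelRetraction_self ht, inv_one, map_one,
    sub_self, zero_mul, LinearMap.zero_apply]

theorem invSubOne_comm_kernelProj (h : ω t' = 1) :
    Commute (invSubOne k t') (kernelProj k t ω) := by
  refine LinearMap.ext fun a => ?_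
  rw [Module.End.mul_apply, Module.End.mul_apply, kernelProj_invSubOne,
    kernelRetraction_of_mem_ker h, invSubOne_apply]

theorem kernelProj_comm (h : ω t' = 1) (h' : ω' t = 1) :
    Commute (kernelProj k t ω) (kernelProj k t' ω') :=
  (basis Γ k).ext fun γ => by
    change kernelProj k t ω (kernelProj k t' ω' (of k Γ γ)) =
      kernelProj k t' ω' (kernelProj k t ω (of k Γ γ))
    simp only [kernelProj_of]
    exact congrArg (of k Γ) (DFunLike.congr_fun (kernelRetraction_comm h h') γ)

theorem range_kernelProj (ht : ω t = Multiplicative.ofAdd 1) :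
    LinearMap.range (kernelProj k t ω) =
      Submodule.span k (basis Γ k '' {γ | ω γ = 1}) := by
  rw [LinearMap.range_eq_map, ← (basis Γ k).span_eq, Submodule.map_span,
    ← range_kernelRetraction ht, ← Set.range_comp, ← Set.range_comp]
  exact congrArg (Submodule.span k <| Set.range ·) (funext (kernelProj_of k t ω))

/-- Elements `t v` of a group with homomorphisms `ω v` to the integers dual to them; such elements
are independent. -/
structure IsDualFamily {V : Type*} (t : V → Γ) (ω : V → Γ →* Multiplicative ℤ) : Prop where
  apply_self : ∀ v, ω v (t v) = Multiplicative.ofAdd 1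
  apply_of_ne : ∀ {v w}, v ≠ w → ω v (t w) = 1

theorem IsDualFamily.exists_isSplitFamily {V : Type*} {t : V → Γ}
    {ω : V → Γ →* Multiplicative ℤ} (h : IsDualFamily t ω) :
    ∃ y, IsSplitFamily (fun v => invSubOne k (t v)) y ∧
      IsAdaptedBasis (basis Γ k) (fun v => invSubOne k (t v)) y fun v => {γ | ω v γ = 1} := by
  choose c hc using fun v => exists_invSubOne_apply_eq k (t v) (ω v)
  let y (v : V) : Module.End k (MonoidAlgebra k Γ) := (basis Γ k).constr k (c v)
  have x_mul_y (v : V) : invSubOne k (t v) * y v = 1 - kernelProj k (t v) (ω v) :=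
    (basis Γ k).ext fun γ => by
      rw [Module.End.mul_apply, Module.Basis.constr_basis, hc, LinearMap.sub_apply]
      exact congrArg (of k Γ γ - ·) (kernelProj_of k (t v) (ω v) γ).symm
  refine ⟨y, .of_isLeftRegular (p := fun v => kernelProj k (t v) (ω v))
    (fun v w => invSubOne_comm k _ _)
    (fun v => isLeftRegular_invSubOne k (injective_zpow_of_apply_eq_ofAdd_one (h.apply_self v)))
    (fun v w => ?_) (fun v w hvw => invSubOne_comm_kernelProj k (h.apply_of_ne hvw.symm))
    (fun v => kernelProj_mul_invSubOne_self k (h.apply_self v)) x_mul_y, fun v => ?_⟩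
  · rcases eq_or_ne v w with rfl | hvw
    · exact Commute.refl _
    · exact kernelProj_comm k (h.apply_of_ne hvw) (h.apply_of_ne hvw.symm)
  · rw [IsSplitFamily.proj, x_mul_y, sub_sub_cancel, range_kernelProj k (h.apply_self v)]

end GroupRing

/-! ### Subquotients -/

section Subquotient

variable {k M N : Type*} [CommRing k] [AddCommGroup M] [Module k M] [AddCommGroup N] [Module k N]

/-- The linear map of subquotients induced by a linear map. -/
def subquotientMap {Z B : Submodule k M} {Z' B' : Submodule k N} (f : M →ₗ[k] N)
    (hZ : ∀ a ∈ Z, f a ∈ Z') (hB : ∀ a ∈ B, f a ∈ B') :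
    (Z ⧸ B.submoduleOf Z) →ₗ[k] (Z' ⧸ B'.submoduleOf Z') :=
  Submodule.mapQ _ _ (f.restrict hZ) fun a ha => hB a ha

/-- A surjective linear map identifies the subquotients of its codomain with those of its domain
obtained by taking preimages. -/
def subquotientEquivOfSurjective {Z B : Submodule k M} {Z' B' : Submodule k N} (f : M →ₗ[k] N)
    (hf : Function.Surjective f) (hZ : Z = Z'.comap f) (hB : B = B'.comap f) :
    (Z ⧸ B.submoduleOf Z) ≃ₗ[k] (Z' ⧸ B'.submoduleOf Z') :=
  LinearEquiv.ofBijective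
    (subquotientMap f (fun _ ha => hZ.le ha) fun _ ha => hB.le ha) <| by
    constructor
    · refine (injective_iff_map_eq_zero _).mpr fun q hq => ?_
      obtain ⟨a, rfl⟩ := Submodule.Quotient.mk_surjective _ q
      exact (Submodule.Quotient.mk_eq_zero _).mpr
        (hB.ge ((Submodule.Quotient.mk_eq_zero (B'.submoduleOf Z')).mp hq))
    · intro q
      obtain ⟨⟨b, hb⟩, rfl⟩ := Submodule.Quotient.mk_surjective _ q
      obtain ⟨a, rfl⟩ := hf b
      exact ⟨Submodule.Quotient.mk ⟨a, hZ.ge hb⟩, rfl⟩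

end Subquotient

section DirectSum

variable {ι k N : Type*} [Semiring k] [AddCommMonoid N] [Module k N] {M : ι → Type*}
  [∀ i, AddCommMonoid (M i)] [∀ i, Module k (M i)]

open DirectSum

theorem bijective_toModule_of_orthogonal [DecidableEq ι] (f : ∀ i, M i →ₗ[k] N)
    (g : ∀ i, N →ₗ[k] M i) (gf_self : ∀ i, g i ∘ₗ f i = LinearMap.id)
    (gf_of_ne : ∀ i j, j ≠ i → g j ∘ₗ f i = 0)
    (span : ∀ n, n ∈ Submodule.span k (Set.range fun i => f i (g i n))) :
    Function.Bijective (toModule k ι N f) := by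
  have component (j : ι) : g j ∘ₗ toModule k ι N f = DirectSum.component k ι M j := by
    ext i m
    rw [LinearMap.comp_apply, LinearMap.comp_apply, LinearMap.comp_apply, toModule_lof]
    rcases eq_or_ne j i with rfl | hji
    · rw [component.lof_self]
      exact LinearMap.congr_fun (gf_self j) m
    · rw [DirectSum.component.of, dif_neg hji.symm]
      exact LinearMap.congr_fun (gf_of_ne i j hji) m
  constructor
  · intro a b hab
    refine ext_component k fun j => ?_
    rw [← component, LinearMap.comp_apply, hab, LinearMap.comp_apply]
  · refine fun n => (Submodule.span_le (p := LinearMap.range (toModule k ι N f))).mpr ?_ (span n)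
    rintro _ ⟨i, rfl⟩
    exact ⟨lof k ι M i (g i n), toModule_lof k i _⟩

end DirectSum

/-! ### Cohomology of a simplicial complex with twisted coefficients -/

section TwistedCohomology

open PreAbstractSimplicialComplex

variable {V : Type u} {k A : Type*} [CommRing k] [AddCommGroup A] [Module k A]
  (K : PreAbstractSimplicialComplex V)

/-- Restriction of cochains on all finite subsets to the simplices with `n` vertices. -/
def restrictSimplices (k A : Type*) [CommRing k] [AddCommGroup A] [Module k A] (n : ℕ) :
    (Finset V → A) →ₗ[k] (K.Simplex n → A) :=
  LinearMap.funLeft k A Simplex.verts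

theorem restrictSimplices_surjective (n : ℕ) :
    Function.Surjective (restrictSimplices K k A n) :=
  LinearMap.funLeft_surjective_of_injective _ _ _ fun _ _ => Simplex.ext

theorem restrictSimplices_eq_iff {n : ℕ} {F G : Finset V → A} :
    restrictSimplices K k A n F = restrictSimplices K k A n G ↔
      ∀ s ∈ K.simplices, s.card = n → F s = G s :=
  ⟨fun h s hs hn => congrFun h ⟨s, hs, hn⟩,
    fun h => funext fun σ => h _ σ.mem_simplices σ.card_eq⟩

variable [LinearOrder V] (x : V → Module.End k A)

/-- The cocycles of degree `p` on `K` with values in `A`, twisted by the operators `x v`, as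
cochains on all finite subsets whose values outside of the simplices with `p` vertices are
arbitrary. -/
def twistedCocycles (p : ℕ) : Submodule k (Finset V → A) :=
  LinearMap.ker (restrictSimplices K k A (p + 1) ∘ₗ twistedCoboundary x)

/-- The coboundaries among the cochains on all finite subsets, up to cochains that vanish on the
simplices of `K` with `p` vertices. -/
def twistedCoboundaries (p : ℕ) : Submodule k (Finset V → A) :=
  LinearMap.range (twistedCoboundary x) ⊔ LinearMap.ker (restrictSimplices K k A p)

/-- The cohomology of `K` with coefficients in `A`, twisted by the operators `x v`. The degree is
the number of vertices of a simplex. Presenting it as a subquotient of the cochains on all finite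
subsets lets the maps between complexes ignore which subsets are simplices. -/
abbrev TwistedCohomology (p : ℕ) : Type _ :=
  ↥(twistedCocycles K x p) ⧸ (twistedCoboundaries K x p).submoduleOf (twistedCocycles K x p)

variable {K x}

theorem mem_twistedCocycles_iff {p : ℕ} {F : Finset V → A} :
    F ∈ twistedCocycles K x p ↔
      ∀ s ∈ K.simplices, s.card = p + 1 → twistedCoboundary x F s = 0 := by
  rw [twistedCocycles, LinearMap.mem_ker, LinearMap.comp_apply,
    ← map_zero (restrictSimplices K k A _), restrictSimplices_eq_iff]
  rfl

theorem mem_twistedCoboundaries_iff {p : ℕ} {F : Finset V → A} :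
    F ∈ twistedCoboundaries K x p ↔
      ∃ G, ∀ s ∈ K.simplices, s.card = p → F s = twistedCoboundary x G s := by
  rw [twistedCoboundaries, Submodule.mem_sup]
  constructor
  · rintro ⟨_, ⟨G, rfl⟩, E, hE, rfl⟩
    refine ⟨G, (restrictSimplices_eq_iff (k := k) K).mp ?_⟩
    rw [map_add, LinearMap.mem_ker.mp hE, add_zero]
  · rintro ⟨G, hG⟩
    refine ⟨_, ⟨G, rfl⟩, F - twistedCoboundary x G, ?_, add_sub_cancel _ _⟩
    rw [LinearMap.mem_ker, map_sub, sub_eq_zero, restrictSimplices_eq_iff]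
    exact hG

theorem mem_twistedCoboundaries_of_eqOn_zero {p : ℕ} {F : Finset V → A}
    (hF : ∀ s ∈ K.simplices, s.card = p → F s = 0) : F ∈ twistedCoboundaries K x p :=
  mem_twistedCoboundaries_iff.mpr ⟨0, by simpa only [map_zero, Pi.zero_apply] using hF⟩

theorem mem_twistedCocycles_of_eqOn_zero {p : ℕ} {F : Finset V → A}
    (hF : ∀ s ∈ K.simplices, s.card = p → F s = 0) : F ∈ twistedCocycles K x p := by
  refine mem_twistedCocycles_iff.mpr fun s hs hcard => ?_
  rw [twistedCoboundary_apply]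
  refine Finset.sum_eq_zero fun v hv => ?_
  rw [hF _ (K.simplices_of_subset hs (Finset.erase_subset v s)), map_zero, smul_zero]
  rw [Finset.card_erase_of_mem hv, hcard, Nat.add_sub_cancel]

theorem map_vertex_univ {n : ℕ} (σ : K.Simplex n) :
    Finset.univ.map σ.vertex.toEmbedding = σ.verts :=
  Finset.map_orderEmbOfFin_univ _ σ.card_eq

theorem vertexSign_vertex {n : ℕ} (σ : K.Simplex n) (i : Fin n) :
    vertexSign k σ.verts (σ.vertex i) = (-1) ^ (i : ℕ) := by
  have below : Finset.univ.filter ((· < σ.vertex i) ∘ σ.vertex.toEmbedding) = Finset.Iio i := by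
    ext j
    simp
  rw [vertexSign, ← map_vertex_univ, Finset.filter_map, Finset.card_map, below, Fin.card_Iio]

theorem twistedCoboundary_verts {n : ℕ} (x : V → Module.End k A) (F : Finset V → A)
    (σ : K.Simplex (n + 1)) :
    twistedCoboundary x F σ.verts =
      ∑ i : Fin (n + 1), (-1 : k) ^ (i : ℕ) • x (σ.vertex i) (F (σ.facet i).verts) := by
  have term (i : Fin (n + 1)) : (-1 : k) ^ (i : ℕ) • x (σ.vertex i) (F (σ.facet i).verts) =
      vertexSign k σ.verts (σ.vertex i) •
        x (σ.vertex i) (F (σ.verts.erase (σ.vertex i))) := by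
    rw [vertexSign_vertex]
    rfl
  simp only [term, twistedCoboundary_apply]
  conv_lhs => rw [← map_vertex_univ σ, Finset.sum_map, map_vertex_univ σ]
  rfl

theorem twistedCoboundaries_zero :
    twistedCoboundaries K x 0 = LinearMap.ker (restrictSimplices K k A 0) := by
  refine sup_eq_right.mpr ?_
  rintro _ ⟨F, rfl⟩
  rw [LinearMap.mem_ker, ← map_zero (restrictSimplices K k A _), restrictSimplices_eq_iff]
  intro s _ hs
  rw [Finset.card_eq_zero.mp hs, twistedCoboundary_apply, Finset.sum_empty, Pi.zero_apply]

/-- The comparison of `TwistedCohomology` with the cohomology of a cochain complex on the simplices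
of `K`. -/
def twistedCohomologyEquiv (d : ∀ n, (K.Simplex n → A) →ₗ[k] (K.Simplex (n + 1) → A))
    (B : ∀ n, Submodule k (K.Simplex n → A))
    (d_restrict : ∀ n, d n ∘ₗ restrictSimplices K k A n =
      restrictSimplices K k A (n + 1) ∘ₗ twistedCoboundary x)
    (B_zero : B 0 = ⊥) (B_succ : ∀ n, B (n + 1) = LinearMap.range (d n)) (p : ℕ) :
    TwistedCohomology K x p ≃ₗ[k] ↥(LinearMap.ker (d p)) ⧸
      (B p).submoduleOf (LinearMap.ker (d p)) :=
  subquotientEquivOfSurjective (restrictSimplices K k A p) (restrictSimplices_surjective K p)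
    (by rw [twistedCocycles, ← d_restrict, LinearMap.ker_comp]) <| by
    cases p with
    | zero => rw [twistedCoboundaries_zero, B_zero, Submodule.comap_bot]
    | succ n =>
      rw [B_succ, ← LinearMap.range_comp_of_range_eq_top (d n)
        (LinearMap.range_eq_top.mpr (restrictSimplices_surjective K n)), d_restrict,
        LinearMap.range_comp, Submodule.comap_map_eq, twistedCoboundaries]

theorem coboundary_comp_restrictSimplices (K : PreAbstractSimplicialComplex V) (k : Type*)
    [CommRing k] (n : ℕ) :
    K.coboundary k n ∘ₗ restrictSimplices K k k n =
      restrictSimplices K k k (n + 1) ∘ₗ twistedCoboundary (1 : V → Module.End k k) := by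
  refine LinearMap.ext fun F => funext fun σ => ?_
  refine Eq.trans ?_ (twistedCoboundary_verts _ F σ).symm
  rfl

/-- Untwisted cohomology is reduced simplicial cohomology, with the degree shifted by one. -/
def twistedCohomologyOneEquiv (K : PreAbstractSimplicialComplex V) (k : Type*) [CommRing k]
    (p : ℕ) :
    TwistedCohomology K (1 : V → Module.End k k) p ≃ₗ[k] K.shiftedReducedCohomology k p :=
  twistedCohomologyEquiv (K.coboundary k) (K.coboundaries k)
    (coboundary_comp_restrictSimplices K k) rfl (fun _ => rfl) p

end TwistedCohomology

section ToricCohomology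

variable {V : Type u} [Finite V] [LinearOrder V] (L : AbstractSimplicialComplex V) (k : Type*)
  [CommRing k]

theorem toricCoboundary_comp_restrictSimplices (n : ℕ) :
    L.toricCells.coboundary (abelianRep k L.ToricGroup) n ∘ₗ
        restrictSimplices L.toPreAbstractSimplicialComplex k
          (MonoidAlgebra k (Abelianization L.ToricGroup)) n =
      restrictSimplices L.toPreAbstractSimplicialComplex k
          (MonoidAlgebra k (Abelianization L.ToricGroup)) (n + 1) ∘ₗ
        twistedCoboundary fun v => invSubOne k (toricLoop L v) := by
  refine LinearMap.ext fun F => funext fun (σ : L.Simplex (n + 1)) => ?_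
  refine Eq.trans ?_ (twistedCoboundary_verts _ F σ).symm
  -- The two opposite facets `xᵢ = 0` and `xᵢ = 1` of the cell `σ` coincide.
  change ∑ i : Fin (n + 1), (-1 : k) ^ (i : ℕ) •
    (abelianRep k L.ToricGroup (L.toricCells.edge σ i)⁻¹ (F (σ.facet i).verts) -
      F (σ.facet i).verts) = _
  refine Finset.sum_congr rfl fun i _ => ?_
  rw [← abelianization_of_edge, invSubOne_apply, sub_mul, one_mul, ← map_inv]
  rfl

/-- The cohomology of the toric complex with coefficients in the group ring of the abelianized
fundamental group, as simplicial cohomology twisted by the operators `t⁻¹ - 1`. -/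
def twistedCohomologyInvSubOneEquiv (p : ℕ) :
    TwistedCohomology L.toPreAbstractSimplicialComplex (fun v => invSubOne k (toricLoop L v)) p
      ≃ₗ[k] L.ToricCohomology (abelianRep k L.ToricGroup) p :=
  twistedCohomologyEquiv (L.toricCells.coboundary (abelianRep k L.ToricGroup))
    (L.toricCells.coboundaries (abelianRep k L.ToricGroup))
    (toricCoboundary_comp_restrictSimplices L k) rfl (fun _ => rfl) p

end ToricCohomology

/-! ### Decomposition into the cohomology of links -/

section LinkDecomposition

open PreAbstractSimplicialComplex DirectSum

variable {V : Type u} [LinearOrder V] {k A Γ : Type*} [CommRing k] [AddCommGroup A] [Module k A]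
  {K : PreAbstractSimplicialComplex V} {r : Finset V} {m p : ℕ}

theorem mem_simplices_link {t : Finset V} (hr : r ∈ K.simplices) :
    t ∈ (K.link r).simplices ↔ Disjoint r t ∧ r ∪ t ∈ K.simplices := by
  rcases t.eq_empty_or_nonempty with rfl | ht
  · simpa [simplices] using hr
  · simp only [simplices, Set.mem_ofPred_eq, ht.ne_empty, false_or]
    exact ⟨fun h => h.2, fun h => ⟨ht, h⟩⟩

variable {x y : V → Module.End k A} (h : IsSplitFamily x y)

theorem linkIncl_congr (hr : r ∈ K.simplices) (a : A) {f g : Finset V → k}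
    (hfg : ∀ t ∈ (K.link r).simplices, t.card = m → f t = g t) {s : Finset V}
    (hs : s ∈ K.simplices) (hcard : s.card = r.card + m) :
    linkIncl h r a f s = linkIncl h r a g s := by
  by_cases hrs : r ⊆ s
  · rw [linkIncl_apply_of_subset h hrs, linkIncl_apply_of_subset h hrs, hfg]
    · rw [mem_simplices_link hr, Finset.union_sdiff_of_subset hrs]
      exact ⟨Finset.disjoint_sdiff, hs⟩
    · rw [Finset.card_sdiff_of_subset hrs, hcard, Nat.add_sub_cancel_left]
  · rw [linkIncl_apply_of_not_subset h hrs, linkIncl_apply_of_not_subset h hrs]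

theorem linkProj_congr (hr : r ∈ K.simplices) (φ : Module.Dual k A) {F G : Finset V → A}
    (hFG : ∀ s ∈ K.simplices, s.card = r.card + m → F s = G s) {t : Finset V}
    (ht : t ∈ (K.link r).simplices) (hcard : t.card = m) :
    linkProj h r φ F t = linkProj h r φ G t := by
  obtain ⟨hrt, hunion⟩ := (mem_simplices_link hr).mp ht
  rw [linkProj_apply, linkProj_apply, hFG _ hunion]
  rw [Finset.card_union_of_disjoint hrt, hcard]

theorem linkIncl_mem_twistedCocycles (hr : r ∈ K.simplices) (hp : r.card + m = p) (a : A)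
    {f : Finset V → k}
    (hf : f ∈ twistedCocycles (K.link r) (1 : V → Module.End k k) m) :
    linkIncl h r a f ∈ twistedCocycles K x p := by
  subst hp
  rw [mem_twistedCocycles_iff] at hf ⊢
  intro s hs hcard
  rw [twistedCoboundary_linkIncl, linkIncl_congr h hr a (g := 0) hf hs hcard, map_zero,
    Pi.zero_apply]

theorem linkIncl_mem_twistedCoboundaries (hr : r ∈ K.simplices) (hp : r.card + m = p) (a : A)
    {f : Finset V → k}
    (hf : f ∈ twistedCoboundaries (K.link r) (1 : V → Module.End k k) m) :
    linkIncl h r a f ∈ twistedCoboundaries K x p := by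
  subst hp
  obtain ⟨g, hg⟩ := mem_twistedCoboundaries_iff.mp hf
  refine mem_twistedCoboundaries_iff.mpr ⟨linkIncl h r a g, fun s hs hcard => ?_⟩
  rw [twistedCoboundary_linkIncl, linkIncl_congr h hr a hg hs hcard]

theorem linkProj_mem_twistedCocycles (hr : r ∈ K.simplices) (hp : r.card + m = p)
    (φ : Module.Dual k A) {F : Finset V → A}
    (hF : F ∈ twistedCocycles K x p) :
    linkProj h r φ F ∈ twistedCocycles (K.link r) (1 : V → Module.End k k) m := by
  subst hp
  rw [mem_twistedCocycles_iff] at hF ⊢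
  intro t ht hcard
  rw [twistedCoboundary_linkProj h φ F ((mem_simplices_link hr).mp ht).1,
    linkProj_congr h hr φ (G := 0) hF ht hcard, map_zero, Pi.zero_apply]

theorem linkProj_mem_twistedCoboundaries (hr : r ∈ K.simplices) (hp : r.card + m = p)
    (φ : Module.Dual k A) {F : Finset V → A}
    (hF : F ∈ twistedCoboundaries K x p) :
    linkProj h r φ F ∈ twistedCoboundaries (K.link r) (1 : V → Module.End k k) m := by
  subst hp
  obtain ⟨G, hG⟩ := mem_twistedCoboundaries_iff.mp hF
  refine mem_twistedCoboundaries_iff.mpr ⟨linkProj h r φ G, fun t ht hcard => ?_⟩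
  rw [twistedCoboundary_linkProj h φ G ((mem_simplices_link hr).mp ht).1,
    linkProj_congr h hr φ hG ht hcard]

/-- The index set of the summands of the twisted cohomology of `K` in degree `p`: a simplex `base`,
the complementary degree `degree`, in which the link of `base` contributes, and an index `elt` of a
basis vector fixed by the projections belonging to the vertices of `base`. -/
structure LinkIndex (K : PreAbstractSimplicialComplex V) (fix : V → Set Γ) (p : ℕ) where
  base : Finset V
  base_mem : base ∈ K.simplices
  degree : ℕ
  card_add_degree : base.card + degree = p
  elt : Γ
  elt_mem : ∀ v ∈ base, elt ∈ fix v

namespace LinkIndex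

variable (b : Module.Basis Γ k A) {fix : V → Set Γ}

/-- The map from the cohomology of a link to the twisted cohomology induced by `linkIncl`. -/
def incl (i : LinkIndex K fix p) :
    TwistedCohomology (K.link i.base) (1 : V → Module.End k k) i.degree →ₗ[k]
      TwistedCohomology K x p :=
  subquotientMap (linkIncl h i.base (b i.elt))
    (fun _ => linkIncl_mem_twistedCocycles h i.base_mem i.card_add_degree _)
    fun _ => linkIncl_mem_twistedCoboundaries h i.base_mem i.card_add_degree _

/-- The map from the twisted cohomology to the cohomology of a link induced by `linkProj`. -/
def proj (i : LinkIndex K fix p) :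
    TwistedCohomology K x p →ₗ[k]
      TwistedCohomology (K.link i.base) (1 : V → Module.End k k) i.degree :=
  subquotientMap (linkProj h i.base (b.coord i.elt))
    (fun _ => linkProj_mem_twistedCocycles h i.base_mem i.card_add_degree _)
    fun _ => linkProj_mem_twistedCoboundaries h i.base_mem i.card_add_degree _

variable {b} (hb : IsAdaptedBasis b x y fix)
include hb

theorem proj_comp_incl_self (i : LinkIndex K fix p) :
    i.proj h b ∘ₗ i.incl h b = LinearMap.id := by
  refine Submodule.linearMap_qext _ (LinearMap.ext fun f => ?_)
  refine (Submodule.Quotient.eq _).mpr (mem_twistedCoboundaries_of_eqOn_zero fun t ht _ => ?_)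
  have hdisj := ((mem_simplices_link i.base_mem).mp ht).1
  refine sub_eq_zero.mpr ((linkProj_linkIncl_apply h hdisj (b.coord i.elt)
    (hb.projProd_apply_basis h i.elt_mem) f).trans ?_)
  rw [b.coord_apply, b.repr_self, Finsupp.single_eq_same, one_mul]

theorem proj_comp_incl_of_ne {i j : LinkIndex K fix p} (hne : j ≠ i) :
    j.proj h b ∘ₗ i.incl h b = 0 := by
  refine Submodule.linearMap_qext _ (LinearMap.ext fun f => ?_)
  refine (Submodule.Quotient.mk_eq_zero _).mpr
    (mem_twistedCoboundaries_of_eqOn_zero fun t ht _ => ?_)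
  change linkProj h j.base (b.coord j.elt) (linkIncl h i.base (b i.elt) f) t = 0
  have fixed := hb.projProd_apply_basis h i.elt_mem
  have hdisj := ((mem_simplices_link j.base_mem).mp ht).1
  by_cases hbase : j.base = i.base
  · have helt : j.elt ≠ i.elt := by
      intro helt
      have hdegree : j.degree = i.degree := by
        have := i.card_add_degree
        have := j.card_add_degree
        rw [hbase] at this
        omega
      cases i
      cases j
      exact hne (by subst hbase helt hdegree; rfl)
    rw [hbase] at hdisj ⊢
    rw [linkProj_linkIncl_apply h hdisj _ fixed, b.coord_apply, b.repr_self,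
      Finsupp.single_eq_of_ne helt, zero_mul]
  · exact linkProj_linkIncl_apply_of_ne h hdisj hbase _ fixed _

theorem mk_linkIncl_linkProj_mem_span {F : Finset V → A} (hF : F ∈ twistedCocycles K x p)
    (r : Finset V) (γ : Γ) :
    ∃ hG : linkIncl h r (b γ) (linkProj h r (b.coord γ) F) ∈ twistedCocycles K x p,
      (Submodule.Quotient.mk ⟨_, hG⟩ : TwistedCohomology K x p) ∈
        Submodule.span k (Set.range fun i : LinkIndex K fix p =>
          i.incl h b (i.proj h b (Submodule.Quotient.mk ⟨F, hF⟩))) := by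
  by_cases hindex : (r ∈ K.simplices ∧ r.card ≤ p) ∧ ∀ v ∈ r, γ ∈ fix v
  · obtain ⟨⟨hr, hcard⟩, hγ⟩ := hindex
    have hp := Nat.add_sub_of_le hcard
    exact ⟨linkIncl_mem_twistedCocycles h hr hp _ (linkProj_mem_twistedCocycles h hr hp _ hF),
      Submodule.subset_span ⟨⟨r, hr, p - r.card, hp, γ, hγ⟩, rfl⟩⟩
  · have vanish (s) (hs : s ∈ K.simplices) (hcard : s.card = p) :
        linkIncl h r (b γ) (linkProj h r (b.coord γ) F) s = 0 := by
      rcases not_and_or.mp hindex with hr | hγ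
      · refine linkIncl_apply_of_not_subset h (fun hrs => hr ⟨?_, ?_⟩) _ _
        · exact K.simplices_of_subset hs hrs
        · exact hcard ▸ Finset.card_le_card hrs
      · have : linkProj h r (b.coord γ) F = 0 := funext fun t => by
          rw [linkProj_apply, Module.End.mul_apply, hb.coord_projProd_eq_zero h hγ, mul_zero,
            Pi.zero_apply]
        rw [this, map_zero, Pi.zero_apply]
    refine ⟨mem_twistedCocycles_of_eqOn_zero vanish, ?_⟩
    have zero : (Submodule.Quotient.mk ⟨_, mem_twistedCocycles_of_eqOn_zero vanish⟩ :
        TwistedCohomology K x p) = 0 :=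
      (Submodule.Quotient.mk_eq_zero _).mpr (mem_twistedCoboundaries_of_eqOn_zero vanish)
    exact zero ▸ Submodule.zero_mem _

theorem mem_span [Finite V] (q : TwistedCohomology K x p) :
    q ∈ Submodule.span k (Set.range fun i : LinkIndex K fix p => i.incl h b (i.proj h b q)) := by
  have := Fintype.ofFinite V
  obtain ⟨⟨F, hF⟩, rfl⟩ := Submodule.Quotient.mk_surjective _ q
  set W := Submodule.span k (Set.range fun i : LinkIndex K fix p =>
    i.incl h b (i.proj h b (Submodule.Quotient.mk ⟨F, hF⟩)))
  obtain ⟨S, hS⟩ := exists_sum_linkIncl_linkProj_eq h b F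
  have mem_map : F ∈ (W.comap (Submodule.mkQ _)).map (twistedCocycles K x p).subtype := by
    rw [← hS]
    refine Submodule.sum_mem _ fun r _ => Submodule.sum_mem _ fun γ _ => ?_
    obtain ⟨hG, hmem⟩ := mk_linkIncl_linkProj_mem_span h hb hF r γ
    exact ⟨⟨_, hG⟩, hmem, rfl⟩
  obtain ⟨G, hG, rfl⟩ := mem_map
  exact hG

theorem bijective_toModule_incl [Finite V] [DecidableEq (LinkIndex K fix p)] :
    Function.Bijective (toModule k (LinkIndex K fix p) (TwistedCohomology K x p)
      fun i => i.incl h b) :=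
  bijective_toModule_of_orthogonal (fun i : LinkIndex K fix p => i.incl h b)
    (fun i => i.proj h b) (proj_comp_incl_self h hb) (fun _ _ => proj_comp_incl_of_ne h hb)
    (mem_span h hb)

end LinkIndex

/-- Twisted cohomology with coefficients split by the operators `x v` is the direct sum of copies
of the untwisted cohomology of the links. -/
def directSumLinkEquiv [Finite V] {b : Module.Basis Γ k A} {fix : V → Set Γ}
    (hb : IsAdaptedBasis b x y fix) (p : ℕ) :
    (⨁ i : LinkIndex K fix p,
      TwistedCohomology (K.link i.base) (1 : V → Module.End k k) i.degree) ≃ₗ[k]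
        TwistedCohomology K x p :=
  open Classical in LinearEquiv.ofBijective _ (LinkIndex.bijective_toModule_incl h hb)

end LinkDecomposition

/-! ### The toric complex -/

section MaximalSimplices

open PreAbstractSimplicialComplex

variable {V : Type u} {K : PreAbstractSimplicialComplex V} {σ : Finset V}

theorem maximal_of_hasDim {d : ℤ} (hK : K.HasDim d) (hσ : σ ∈ K.simplices)
    (hcard : (σ.card : ℤ) = d + 1) : Maximal (· ∈ K.simplices) σ := by
  refine ⟨hσ, fun τ hτ hστ => (Finset.eq_of_subset_of_card_le hστ ?_).ge⟩
  have := hK.1 τ hτ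
  omega

theorem hasDim_of_maximal_card [Finite V] {d : ℤ}
    (hcard : ∀ σ, Maximal (· ∈ K.simplices) σ → (σ.card : ℤ) = d + 1) : K.HasDim d := by
  have exists_maximal (σ) (hσ : σ ∈ K.simplices) :=
    K.simplices.toFinite.exists_le_maximal hσ
  constructor
  · intro σ hσ
    obtain ⟨τ, hστ, hτ⟩ := exists_maximal σ hσ
    rw [← hcard τ hτ]
    exact_mod_cast Finset.card_le_card hστ
  · obtain ⟨τ, -, hτ⟩ := exists_maximal ∅ (Or.inl rfl)
    exact ⟨τ, hτ.1, hcard τ hτ⟩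

variable [LinearOrder V]

theorem faces_link_eq_empty_of_maximal (hσ : Maximal (· ∈ K.simplices) σ) :
    (K.link σ).faces = ∅ := by
  refine Set.eq_empty_of_forall_notMem fun τ ⟨hτ, hdisj, hunion⟩ => hτ.ne_empty ?_
  exact hdisj.symm.eq_bot_of_le
    (Finset.subset_union_right.trans (hσ.le_of_ge hunion Finset.subset_union_left))

theorem nontrivial_shiftedReducedCohomology_zero (k : Type*) [CommRing k] [Nontrivial k]
    (hK : K.faces = ∅) : Nontrivial (K.shiftedReducedCohomology k 0) := by
  have : IsEmpty (K.Simplex 1) := by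
    refine ⟨fun ⟨τ, hτ, hcard⟩ => ?_⟩
    rcases hτ with rfl | hτ
    · exact zero_ne_one hcard
    · exact (hK ▸ hτ : τ ∈ (∅ : Set (Finset V)))
  let c : LinearMap.ker (K.coboundary k 0) := ⟨1, Subsingleton.elim _ _⟩
  refine ⟨Submodule.Quotient.mk c, 0, fun hc => ?_⟩
  have hc : (1 : K.Simplex 0 → k) = 0 := (Submodule.Quotient.mk_eq_zero _).mp hc
  exact one_ne_zero (congrFun hc ⟨∅, Or.inl rfl, Finset.card_empty⟩)

end MaximalSimplices

section ToricComplex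

open PreAbstractSimplicialComplex DirectSum

variable {V : Type u} (L : AbstractSimplicialComplex V)

/-- The index set of the summands of the cohomology of the toric complex. -/
abbrev ToricLinkIndex (p : ℕ) : Type _ :=
  LinkIndex L.toPreAbstractSimplicialComplex (fun v => {γ | toricWinding L v γ = 1}) p

-- The neutral element of the group serves as an index for every simplex.
theorem forall_toricLinkIndex_iff {p : ℕ} {P : Finset V → ℕ → Prop} :
    (∀ i : ToricLinkIndex L p, P i.base i.degree) ↔
      ∀ σ ∈ L.simplices, ∀ n, σ.card + n = p → P σ n :=
  ⟨fun h σ hσ n hn => h ⟨σ, hσ, n, hn, 1, fun v _ => map_one (toricWinding L v)⟩,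
    fun h i => h i.base i.base_mem i.degree i.card_add_degree⟩

variable [Finite V] [LinearOrder V]

theorem isDualFamily_toricLoop : IsDualFamily (toricLoop L) (toricWinding L) :=
  ⟨toricWinding_toricLoop_self L, toricWinding_toricLoop_of_ne L⟩

variable (k : Type*) [CommRing k]

theorem nonempty_directSum_link_equiv_toricCohomology (p : ℕ) :
    Nonempty ((⨁ i : ToricLinkIndex L p, (L.link i.base).shiftedReducedCohomology k i.degree) ≃ₗ[k]
      L.ToricCohomology (abelianRep k L.ToricGroup) p) := by
  obtain ⟨y, h, hb⟩ := (isDualFamily_toricLoop L).exists_isSplitFamily k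
  exact ⟨congrLinearEquiv (fun i : ToricLinkIndex L p =>
      (twistedCohomologyOneEquiv (L.link i.base) k i.degree).symm) ≪≫ₗ
    directSumLinkEquiv h hb p ≪≫ₗ twistedCohomologyInvSubOneEquiv L k p⟩

variable {k}

theorem subsingleton_toricCohomology_iff {p : ℕ} :
    Subsingleton (L.ToricCohomology (abelianRep k L.ToricGroup) p) ↔
      ∀ σ ∈ L.simplices, ∀ n, σ.card + n = p →
        Subsingleton ((L.link σ).shiftedReducedCohomology k n) := by
  classical
  obtain ⟨e⟩ := nonempty_directSum_link_equiv_toricCohomology L k p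
  rw [← forall_toricLinkIndex_iff, ← e.toEquiv.subsingleton_congr]
  exact ⟨fun _ i => (DirectSum.of_injective (β := fun i : ToricLinkIndex L p =>
    (L.link i.base).shiftedReducedCohomology k i.degree) i).subsingleton, fun h =>
    ⟨fun a b => DFinsupp.ext fun i => (h i).elim _ _⟩⟩

theorem isTorsionFree_toricCohomology_iff {p : ℕ} :
    Module.IsTorsionFree k (L.ToricCohomology (abelianRep k L.ToricGroup) p) ↔
      ∀ σ ∈ L.simplices, ∀ n, σ.card + n = p →
        Module.IsTorsionFree k ((L.link σ).shiftedReducedCohomology k n) := by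
  classical
  obtain ⟨e⟩ := nonempty_directSum_link_equiv_toricCohomology L k p
  rw [← forall_toricLinkIndex_iff]
  constructor
  · intro _ i
    let f := e.toLinearMap ∘ₗ DirectSum.lof k _
      (fun i : ToricLinkIndex L p => (L.link i.base).shiftedReducedCohomology k i.degree) i
    have hf : Function.Injective f := e.injective.comp (DirectSum.of_injective i)
    exact hf.moduleIsTorsionFree f (map_smul f)
  · intro h
    let f := LinearMap.pi (DirectSum.component k _ _) ∘ₗ e.symm.toLinearMap
    have hf : Function.Injective f := DFunLike.coe_injective.comp e.symm.injective
    exact hf.moduleIsTorsionFree f (map_smul f)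

instance finite_simplex (K : PreAbstractSimplicialComplex V) (n : ℕ) : Finite (K.Simplex n) :=
  .of_injective Simplex.verts fun _ _ => Simplex.ext

theorem free_toricCohomology_iff [IsDomain k] [IsPrincipalIdealRing k] {p : ℕ} :
    Module.Free k (L.ToricCohomology (abelianRep k L.ToricGroup) p) ↔
      Module.IsTorsionFree k (L.ToricCohomology (abelianRep k L.ToricGroup) p) := by
  refine ⟨fun _ => inferInstance, fun h => ?_⟩
  rw [isTorsionFree_toricCohomology_iff, ← forall_toricLinkIndex_iff] at h
  obtain ⟨e⟩ := nonempty_directSum_link_equiv_toricCohomology L k p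
  have (i : ToricLinkIndex L p) :
      Module.Free k ((L.link i.base).shiftedReducedCohomology k i.degree) := by
    have := h i
    exact Module.free_of_finite_type_torsion_free'
  exact Module.Free.of_equiv e

theorem nontrivial_toricCohomology_of_maximal [Nontrivial k] {σ : Finset V}
    (hσ : Maximal (· ∈ L.simplices) σ) :
    Nontrivial (L.ToricCohomology (abelianRep k L.ToricGroup) σ.card) := by
  rw [← not_subsingleton_iff_nontrivial, subsingleton_toricCohomology_iff]
  intro h
  have := nontrivial_shiftedReducedCohomology_zero k (faces_link_eq_empty_of_maximal hσ)
  exact not_subsingleton _ (h σ hσ.1 0 rfl)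

theorem isCohenMacaulay_iff_isTorsionFree [Nontrivial k] (d : ℤ) :
    L.IsCohenMacaulay k d ↔
      (∀ p : ℕ, (p : ℤ) ≠ d + 1 →
        Subsingleton (L.ToricCohomology (abelianRep k L.ToricGroup) p)) ∧
      (∀ p : ℕ, (p : ℤ) = d + 1 →
        Module.IsTorsionFree k (L.ToricCohomology (abelianRep k L.ToricGroup) p)) := by
  constructor
  · rintro ⟨-, hlink⟩
    refine ⟨fun p hp => (subsingleton_toricCohomology_iff L).mpr fun σ hσ n hn => ?_,
      fun p hp => (isTorsionFree_toricCohomology_iff L).mpr fun σ hσ n hn => ?_⟩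
    · exact (hlink σ hσ n).1 (by omega)
    · exact (hlink σ hσ n).2 (by omega)
  · rintro ⟨vanish, torsionFree⟩
    refine ⟨hasDim_of_maximal_card fun σ hσ => ?_, fun σ hσ n => ⟨fun hn => ?_, fun hn => ?_⟩⟩
    · by_contra hcard
      have := nontrivial_toricCohomology_of_maximal (k := k) L hσ
      exact not_subsingleton _ (vanish _ hcard)
    · exact (subsingleton_toricCohomology_iff L).mp (vanish (σ.card + n) (by omega)) σ hσ n rfl
    · exact (isTorsionFree_toricCohomology_iff L).mp (torsionFree (σ.card + n) (by omega))
        σ hσ n rfl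

theorem isCohenMacaulay_iff_free [IsDomain k] [IsPrincipalIdealRing k] (d : ℤ) :
    L.IsCohenMacaulay k d ↔
      (∀ p : ℕ, (p : ℤ) ≠ d + 1 →
        Subsingleton (L.ToricCohomology (abelianRep k L.ToricGroup) p)) ∧
      (∀ p : ℕ, (p : ℤ) = d + 1 →
        Module.Free k (L.ToricCohomology (abelianRep k L.ToricGroup) p)) := by
  simp only [isCohenMacaulay_iff_isTorsionFree, free_toricCohomology_iff]

theorem isAbelianDualitySpace_iff_isCohenMacaulay (n : ℕ) :
    L.toricCells.IsAbelianDualitySpace n ↔ L.IsCohenMacaulay ℤ ((n : ℤ) - 1) := by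
  constructor
  · rintro ⟨-, vanish, -, torsionFree⟩
    refine (isCohenMacaulay_iff_isTorsionFree L _).mpr
      ⟨fun p hp => vanish p (by omega), fun p hp => ?_⟩
    obtain rfl : p = n := by omega
    exact torsionFree
  · intro h
    obtain ⟨vanish, torsionFree⟩ := (isCohenMacaulay_iff_isTorsionFree L _).mp h
    refine ⟨finite_simplex _, fun p hp => vanish p (by omega), ?_, torsionFree n (by omega)⟩
    obtain ⟨σ, hσ, hcard⟩ := h.1.2
    obtain rfl : σ.card = n := by omega
    exact nontrivial_toricCohomology_of_maximal L (maximal_of_hasDim h.1 hσ hcard)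

theorem exists_isAbelianDualitySpace_iff_exists_isCohenMacaulay :
    (∃ n : ℕ, L.toricCells.IsAbelianDualitySpace n) ↔ ∃ d : ℤ, L.IsCohenMacaulay ℤ d := by
  simp only [isAbelianDualitySpace_iff_isCohenMacaulay]
  refine ⟨fun ⟨n, h⟩ => ⟨_, h⟩, fun ⟨d, h⟩ => ?_⟩
  obtain ⟨σ, -, hcard⟩ := h.1.2
  exact ⟨σ.card, by rwa [hcard, add_sub_cancel_right]⟩

end ToricComplex

theorem isDomain_and_isPrincipalIdealRing_of_isField_or_ringEquiv_int {k : Type*} [CommRing k]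
    (hk : IsField k ∨ Nonempty (k ≃+* ℤ)) : IsDomain k ∧ IsPrincipalIdealRing k := by
  rcases hk with hk | ⟨⟨e⟩⟩
  · exact ⟨hk.isDomain, hk.isPrincipalIdealRing⟩
  · exact ⟨MulEquiv.isDomain ℤ e.toMulEquiv,
      IsPrincipalIdealRing.of_surjective e.symm.toRingHom e.symm.surjective⟩

end

theorem mainTheorem12_general {V : Type u} [Finite V] [LinearOrder V]
    (L : AbstractSimplicialComplex V) :
    (∀ (k : Type w) [CommRing k] [IsDomain k] [IsPrincipalIdealRing k], ∀ d : ℤ,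
      (L.IsCohenMacaulay k d ↔
        (∀ p : ℕ, (p : ℤ) ≠ d + 1 →
          Subsingleton (L.ToricCohomology (abelianRep k L.ToricGroup) p)) ∧
        (∀ p : ℕ, (p : ℤ) = d + 1 →
          Module.Free k (L.ToricCohomology (abelianRep k L.ToricGroup) p)))) ∧
    (∀ n : ℕ, L.toricCells.IsAbelianDualitySpace n ↔ L.IsCohenMacaulay ℤ ((n : ℤ) - 1)) ∧
    ((∃ n : ℕ, L.toricCells.IsAbelianDualitySpace n) ↔ ∃ d : ℤ, L.IsCohenMacaulay ℤ d) :=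
  ⟨fun _ => isCohenMacaulay_iff_free L, isAbelianDualitySpace_iff_isCohenMacaulay L,
    exists_isAbelianDualitySpace_iff_exists_isCohenMacaulay L⟩

theorem mainTheorem12 {V : Type u} [Finite V] [LinearOrder V] (L : AbstractSimplicialComplex V) :
    (∀ (k : Type w) [CommRing k], (IsField k ∨ Nonempty (k ≃+* ℤ)) → ∀ d : ℤ,
      (L.IsCohenMacaulay k d ↔
        (∀ p : ℕ, (p : ℤ) ≠ d + 1 →
          Subsingleton (L.ToricCohomology (abelianRep k L.ToricGroup) p)) ∧
        (∀ p : ℕ, (p : ℤ) = d + 1 →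
          Module.Free k (L.ToricCohomology (abelianRep k L.ToricGroup) p)))) ∧
    (∀ n : ℕ, L.toricCells.IsAbelianDualitySpace n ↔ L.IsCohenMacaulay ℤ ((n : ℤ) - 1)) ∧
    ((∃ n : ℕ, L.toricCells.IsAbelianDualitySpace n) ↔ ∃ d : ℤ, L.IsCohenMacaulay ℤ d) :=
  (mainTheorem12_general L).imp_left fun main _ _ hk =>
    have ⟨_, _⟩ := isDomain_and_isPrincipalIdealRing_of_isField_or_ringEquiv_int hk; main _
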